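/- **Notation.** For a finite set $S\subset\mathbb C^2$ let $m_j(S)$ be the maximum number of points of $S$ contained in an algebraic curve of degree $j$ (the zero set of a polynomial of degree $j$). A conic is an algebraic curve of degree 2. For $u\in PSH(\mathbb C^2)$ put $\gamma_u=\limsup_{\|z\|\to\infty}u(z)/\log\|z\|$; $u$ has logarithmic growth if $\gamma_u<+\infty$. It has a logarithmic pole of weight $\alpha>0$ at $p$ if $u(z)=\alpha\log\|z-p\|+O(1)$ for $z$ near $p$. An entire pluricomplex Green function of a finite set $S$ is a function $u\in PSH(\mathbb C^2)$ of logarithmic growth which is locally bounded and maximal on $\mathbb C^2\setminus S$ and equals $-\infty$ on $S$. **Proposition 2.4.** Let $A\subset\mathbb C^2$ with $|A|=7$, $m_1(A)\le 3$, $m_2(A)=6$, and let $\Gamma$ be the conic with $|A\cap\Gamma|=6$. Let $q\in\mathbb C^2\setminus(A\cup\Gamma)$. Then $m_1(A\cup\{q\})\le 4$, and: (i) If $m_1(A\cup\{q\})\le 3$, there exists $u\in PSH(\mathbb C^2)$ with $\gamma_u=3$ such that $u$ is locally bounded outside a finite set and $u(z)\le\log\|z-p\|+O(1)$ for $z$ near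 each point $p\in A\cup\{q\}$. (ii) If $m_1(A\cup\{q\})=4$, there exists a subset $S\subset A\cup\{q\}$ with $|S|=7$ which has an entire pluricomplex Green function $u$ with $\gamma_u=4$ such that $u$ has logarithmic poles of weight 2 at 3 of the points of $S$ and of weight 1 at the remaining 4 points of $S$. -/

import Mathlib

open Filter Topology MeasureTheory

namespace PluriGreen

/-- The complex Euclidean space `ℂⁿ`. -/
abbrev Cn (n : ℕ) : Type := EuclideanSpace ℂ (Fin n)

/-! ### Plane algebraic curves and the numbers `m_j(S)` -/

/-- `Z ⊆ ℂ²` is an algebraic curve of degree `d`: the zero set of a polynomial of degree `d` in two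
variables (multiple components are allowed and counted with multiplicity in the degree).
Lines are the curves of degree `1`, conics are the curves of degree `2`. -/
def IsAlgCurve (d : ℕ) (Z : Set (Cn 2)) : Prop :=
  ∃ P : MvPolynomial (Fin 2) ℂ, P.totalDegree = d ∧
    Z = {z | MvPolynomial.eval (fun i => z i) P = 0}

/-- `m_j(S)`: the maximum number of points of the finite set `S ⊆ ℂ²` which are contained in an
algebraic curve of degree `j` (the numbers below are bounded by `|S|`). -/
noncomputable def maxOnCurve (j : ℕ) (S : Finset (Cn 2)) : ℕ :=
  sSup {k : ℕ | ∃ Z : Set (Cn 2), IsAlgCurve j Z ∧ ((S : Set (Cn 2)) ∩ Z).ncard = k}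

/-! ### Plurisubharmonic functions -/

/-- The mean `(2π)⁻¹ ∫₀^{2π} u(a + e^{iθ} b) dθ` of a function with values in `[-∞, ∞)` over the
circle `θ ↦ a + e^{iθ} b`, as the integral of the positive part minus the integral of the negative
part. For `u` upper semicontinuous with values `< ∞` the first integral is finite, so that
the difference is a well defined element of `[-∞, ∞)`. -/
noncomputable def circleMean {n : ℕ} (u : Cn n → EReal) (a b : Cn n) : EReal :=
  (((2 * Real.pi)⁻¹ : ℝ) : EReal) *
    (((∫⁻ θ in Set.Ioc 0 (2 * Real.pi), (u (a + circleMap 0 1 θ • b)).toENNReal : ENNReal) : EReal)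
      - ((∫⁻ θ in Set.Ioc 0 (2 * Real.pi), (-u (a + circleMap 0 1 θ • b)).toENNReal : ENNReal) :
          EReal))

/-- `u ∈ PSH(D)`, for `D ⊆ ℂⁿ` open: `u : D → [-∞, ∞)` is upper semicontinuous, satisfies the
sub-mean value inequality on every closed disc of a complex line contained in `D`, and is not
identically `-∞` on any connected component of `D`. (Values of `u` outside `D` play no role.) -/
structure IsPSH {n : ℕ} (u : Cn n → EReal) (D : Set (Cn n)) : Prop where
  lt_top : ∀ z ∈ D, u z < ⊤
  usc : UpperSemicontinuousOn u D
  submean : ∀ a b : Cn n, (∀ ζ : ℂ, ‖ζ‖ ≤ 1 → a + ζ • b ∈ D) → u a ≤ circleMean u a b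
  ne_bot : ∀ x ∈ D, ∃ y ∈ connectedComponentIn D x, u y ≠ ⊥

/-- `u` is locally bounded on the open set `D`. -/
def LocallyBddOn {n : ℕ} (u : Cn n → EReal) (D : Set (Cn n)) : Prop :=
  ∀ x ∈ D, ∃ M : ℝ, ∀ᶠ z in 𝓝 x, ((-M : ℝ) : EReal) ≤ u z ∧ u z ≤ (M : EReal)

/-- `u` is maximal on the open set `D`: whenever `G` is open and relatively compact in `D`, `v` is
upper semicontinuous on the closure of `G` and plurisubharmonic on `G`, and `v ≤ u` on the boundary
of `G`, then `v ≤ u` on `G`. -/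
def IsMaximalOn {n : ℕ} (u : Cn n → EReal) (D : Set (Cn n)) : Prop :=
  ∀ (G : Set (Cn n)) (v : Cn n → EReal), IsOpen G → IsCompact (closure G) → closure G ⊆ D →
    UpperSemicontinuousOn v (closure G) → IsPSH v G → (∀ z ∈ frontier G, v z ≤ u z) →
    ∀ z ∈ G, v z ≤ u z

/-- The growth constant `γ_u = limsup_{‖z‖ → ∞} u(z) / log ‖z‖`. -/
noncomputable def growth {n : ℕ} (u : Cn n → EReal) : EReal :=
  limsup (fun z => u z / (Real.log ‖z‖ : EReal)) (Bornology.cobounded (Cn n))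

/-- `log ‖z - p‖` as an element of `[-∞, ∞)`, equal to `-∞` at `z = p`. -/
noncomputable def logDist {n : ℕ} (z p : Cn n) : EReal := ENNReal.log ‖z - p‖ₑ

/-- `u(z) ≤ α log ‖z - p‖ + O(1)` for `z` near `p`. -/
def LogUpperBoundAt {n : ℕ} (u : Cn n → EReal) (α : ℝ) (p : Cn n) : Prop :=
  ∃ M : ℝ, ∀ᶠ z in 𝓝 p, u z ≤ (α : EReal) * logDist z p + (M : EReal)

/-- `u` has a logarithmic pole of weight `α` at `p`, i.e. `u(z) = α log ‖z - p‖ + O(1)` for `z`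
near `p`. -/
def HasLogPole {n : ℕ} (u : Cn n → EReal) (α : ℝ) (p : Cn n) : Prop :=
  ∃ M : ℝ, ∀ᶠ z in 𝓝 p, (α : EReal) * logDist z p - (M : EReal) ≤ u z ∧
    u z ≤ (α : EReal) * logDist z p + (M : EReal)

/-- `u` is an entire pluricomplex Green function of the finite set `S ⊆ ℂⁿ`: it is plurisubharmonic
on `ℂⁿ` with logarithmic growth, locally bounded and maximal on `ℂⁿ \ S`, and `-∞` on `S`. -/
structure IsEntireGreen {n : ℕ} (S : Finset (Cn n)) (u : Cn n → EReal) : Prop where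
  psh : IsPSH u Set.univ
  log_growth : growth u < ⊤
  locallyBdd : LocallyBddOn u (S : Set (Cn n))ᶜ
  maximal : IsMaximalOn u (S : Set (Cn n))ᶜ
  eq_bot : ∀ p ∈ S, u p = ⊥

end PluriGreen

namespace PluriGreen

/-! ### Circle means -/

/-! All the functions required are `log ‖Φ‖` for polynomial maps Φ = (P, Q) of ℂ². Such a function
is plurisubharmonic because, at a point a, it dominates the logarithm of the modulus of the
normalised holomorphic component of Φ along Φ(a), with equality at a. Its growth is the larger of
the two degrees, it is locally bounded off the common zeros, and its poles are read off from
two-sided estimates of ‖Φ‖. It is maximal off the zeros (`isMaximalOn_logNorm`): the map [Φ] to the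
projective line has a kernel direction at each point, and along it `log ‖Φ‖` is harmonic to second
order.

(i) Take two cubics through the eight points, the second also through a point off the first. A
common component would leave residual curves with enough prescribed points to be proportional
(`conic_unique` is the main case), contradicting the choice of the extra point. So the common zeros
are finite. A conic through seven of the eight points would meet A ∩ Γ in at least five points,
hence would be Γ, and would contain q.

(ii) The line ℓ with four points contains q, the point w of A off Γ, and exactly two points of A ∩
Γ. Drop one of these two, keep the other as y, and call the remaining points of A ∩ Γ i, j, k, l.
With double points a, b, c = y, i, j and simple points s₁, …, s₄ = k, l, w, q, write C(s, t) for the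
conic through a, b, c, s, t. The two quartics are C(s₁,s₂)C(s₃,s₄) and C(s₁,s₃)C(s₂,s₄). After the
Cremona transformation at a, b, c these are two pairs of opposite sides of a complete quadrangle.
Intersection multiplicities 3·4 + 4·1 = 16 exhaust Bézout's number, which is why no further zero can
occur. General position needs the sᵢ off the sides of the triangle and no three of them on a conic
with a, b, c. The latter holds because Γ is the only conic through y, i, j, k, l, while a conic
containing y, w, q contains ℓ. The former is arranged by the choice of i, j, which depends on
whether A ∩ Γ has three collinear points. -/

lemma coe_circleAverage {g : ℂ → ℝ} (hg : CircleIntegrable g 0 1) :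
    ((Real.circleAverage g 0 1 : ℝ) : EReal) = (((2 * Real.pi)⁻¹ : ℝ) : EReal) *
      (((∫⁻ θ in Set.Ioc 0 (2 * Real.pi),
            ((g (circleMap 0 1 θ) : ℝ) : EReal).toENNReal : ENNReal) : EReal)
        - ((∫⁻ θ in Set.Ioc 0 (2 * Real.pi),
            (-((g (circleMap 0 1 θ) : ℝ) : EReal)).toENNReal : ENNReal) : EReal)) := by
  have hint : IntegrableOn (fun θ => g (circleMap 0 1 θ)) (Set.Ioc 0 (2 * Real.pi)) :=
    (intervalIntegrable_iff_integrableOn_Ioc_of_le Real.two_pi_pos.le).1 hg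
  rw [Real.circleAverage_def, intervalIntegral.integral_of_le Real.two_pi_pos.le,
    integral_eq_lintegral_pos_part_sub_lintegral_neg_part hint, smul_eq_mul, EReal.coe_mul,
    EReal.coe_sub]
  have h1 : (∫⁻ θ in Set.Ioc 0 (2 * Real.pi), ENNReal.ofReal (g (circleMap 0 1 θ))) ≠ ⊤ :=
    hint.lintegral_lt_top.ne
  have h2 : (∫⁻ θ in Set.Ioc 0 (2 * Real.pi), ENNReal.ofReal (-g (circleMap 0 1 θ))) ≠ ⊤ :=
    hint.neg.lintegral_lt_top.ne
  simp_rw [← EReal.coe_neg, EReal.real_coe_toENNReal]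
  rw [EReal.coe_ennreal_toReal h1, EReal.coe_ennreal_toReal h2]

/-- The bound is only asked almost everywhere: in the application g is built from `Real.log ‖F‖`,
which takes the default value 0 at zeros of F, where u may be -∞. -/
lemma circleAverage_le_circleMean {n : ℕ} {u : Cn n → EReal} {a b : Cn n} {g : ℂ → ℝ}
    (hg : CircleIntegrable g 0 1)
    (h : ∀ᵐ θ ∂(volume.restrict (Set.Ioc 0 (2 * Real.pi))),
      ((g (circleMap 0 1 θ) : ℝ) : EReal) ≤ u (a + circleMap 0 1 θ • b)) :
    ((Real.circleAverage g 0 1 : ℝ) : EReal) ≤ circleMean u a b := by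
  rw [coe_circleAverage hg, circleMean]
  refine mul_le_mul_of_nonneg_left (EReal.sub_le_sub ?_ ?_)
    (EReal.coe_nonneg.2 (by positivity))
  · refine EReal.coe_ennreal_le_coe_ennreal_iff.2 (lintegral_mono_ae ?_)
    filter_upwards [h] with θ hθ using EReal.toENNReal_le_toENNReal hθ
  · refine EReal.coe_ennreal_le_coe_ennreal_iff.2 (lintegral_mono_ae ?_)
    filter_upwards [h] with θ hθ using
      EReal.toENNReal_le_toENNReal (EReal.neg_le_neg_iff.2 hθ)

lemma circleMean_le_circleAverage {n : ℕ} {u : Cn n → EReal} {a b : Cn n} {g : ℂ → ℝ}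
    (hg : CircleIntegrable g 0 1)
    (h : ∀ θ, u (a + circleMap 0 1 θ • b) ≤ ((g (circleMap 0 1 θ) : ℝ) : EReal)) :
    circleMean u a b ≤ ((Real.circleAverage g 0 1 : ℝ) : EReal) := by
  rw [coe_circleAverage hg, circleMean]
  refine mul_le_mul_of_nonneg_left (EReal.sub_le_sub ?_ ?_)
    (EReal.coe_nonneg.2 (by positivity))
  · exact EReal.coe_ennreal_le_coe_ennreal_iff.2
      (lintegral_mono fun θ => EReal.toENNReal_le_toENNReal (h θ))
  · exact EReal.coe_ennreal_le_coe_ennreal_iff.2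
      (lintegral_mono fun θ => EReal.toENNReal_le_toENNReal (EReal.neg_le_neg_iff.2 (h θ)))

/-- The submean inequality for `log |F|`, `F` entire. -/
lemma log_norm_le_circleAverage {F : ℂ → ℂ} (hF : Differentiable ℂ F) (h0 : F 0 ≠ 0) :
    Real.log ‖F 0‖ ≤ Real.circleAverage (fun z => Real.log ‖F z‖) 0 1 := by
  have han : AnalyticOnNhd ℂ F (Metric.closedBall 0 |1|) :=
    fun z _ => hF.analyticAt z
  -- Jensen's formula. An entire function has no poles, so the divisor terms are nonnegative on the
  -- unit disc and may be dropped.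
  have hJ := MeromorphicOn.circleAverage_log_norm (c := 0) (R := 1) one_ne_zero
    han.meromorphicOn
  have htr : meromorphicTrailingCoeffAt F 0 = F 0 :=
    (hF.analyticAt 0).meromorphicTrailingCoeffAt_of_ne_zero h0
  have hpos : 0 ≤ ∑ᶠ u, (MeromorphicOn.divisor F (Metric.closedBall 0 |1|) u : ℝ) *
      Real.log (1 * ‖0 - u‖⁻¹) := by
    refine finsum_nonneg fun u => ?_
    by_cases hu : u ∈ Metric.closedBall (0 : ℂ) |1|
    · refine mul_nonneg ?_ ?_
      · exact_mod_cast (MeromorphicOn.AnalyticOnNhd.divisor_nonneg han) u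
      · have hu' : ‖u‖ ≤ 1 := by simpa using hu
        rcases eq_or_ne u 0 with rfl | hne
        · simp
        · refine Real.log_nonneg ?_
          rw [one_mul, zero_sub, norm_neg]
          exact (one_le_inv₀ (norm_pos_iff.2 hne)).2 hu'
    · rw [Function.locallyFinsuppWithin.apply_eq_zero_of_notMem _ hu]
      simp
  rw [hJ, htr]
  simp only [Real.log_one, mul_zero, add_zero]
  linarith

/-- The zeros of a nonzero entire function are discrete, so they meet the circle in a null set. -/
lemma ae_circleMap_ne_zero {F : ℂ → ℂ} (hF : Differentiable ℂ F) (h0 : F 0 ≠ 0) :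
    ∀ᵐ θ ∂(volume.restrict (Set.Ioc 0 (2 * Real.pi))), F (circleMap 0 1 θ) ≠ 0 := by
  have h1 : F ⁻¹' {0}ᶜ ∈ codiscreteWithin (Set.univ : Set ℂ) :=
    AnalyticOnNhd.preimage_zero_mem_codiscreteWithin (x := 0)
      (fun z _ => hF.analyticAt z) h0 trivial isConnected_univ
  have h2 := circleMap_preimage_codiscrete (c := 0) (R := 1) one_ne_zero
    (codiscreteWithin_mono (Set.subset_univ _) h1)
  have h3 : ∀ᵐ θ ∂(volume.restrict (Set.Ioc 0 (2 * Real.pi))), circleMap 0 1 θ ∈ F ⁻¹' {0}ᶜ :=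
    ae_restrict_le_codiscreteWithin measurableSet_Ioc
      (codiscreteWithin_mono (Set.subset_univ _) h2)
  filter_upwards [h3] with θ hθ using hθ

/-! ### The function `log ‖Φ‖` -/

/-- The function `log ‖Φ‖`, with value `-∞` on the zeros of `Φ`. -/
noncomputable def logNorm {n m : ℕ} (Φ : Cn n → Cn m) (z : Cn n) : EReal := ENNReal.log ‖Φ z‖ₑ

lemma logNorm_of_ne {n m : ℕ} {Φ : Cn n → Cn m} {z : Cn n} (h : Φ z ≠ 0) :
    logNorm Φ z = ((Real.log ‖Φ z‖ : ℝ) : EReal) := by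
  rw [logNorm, ← ofReal_norm, ENNReal.log_ofReal_of_pos (norm_pos_iff.2 h)]

lemma continuous_logNorm {n m : ℕ} {Φ : Cn n → Cn m} (h : Continuous Φ) :
    Continuous (logNorm Φ) :=
  ENNReal.continuous_log.comp h.enorm

lemma logNorm_lt_top {n m : ℕ} (Φ : Cn n → Cn m) (z : Cn n) : logNorm Φ z < ⊤ := by
  simp [logNorm]

/-- Reduction to one holomorphic function: by Cauchy–Schwarz the component F of Φ along Φ(a)
satisfies log|F| - log‖Φ(a)‖ ≤ log‖Φ‖, with equality at the centre, and log|F| has the submean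
property. -/
lemma logNorm_submean {n m : ℕ} {Φ : Cn n → Cn m} (hΦ : Differentiable ℂ Φ) (a b : Cn n) :
    logNorm Φ a ≤ circleMean (logNorm Φ) a b := by
  by_cases h0 : Φ a = 0
  · simp [logNorm, h0]
  set F : ℂ → ℂ := fun ζ => inner ℂ (Φ a) (Φ (a + ζ • b)) with hFdef
  have hN : 0 < ‖Φ a‖ := norm_pos_iff.2 h0
  have hF : Differentiable ℂ F := by
    have h1 : Differentiable ℂ fun ζ : ℂ => Φ (a + ζ • b) :=
      hΦ.comp ((differentiable_const a).add (differentiable_id.smul_const b))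
    exact (innerSL ℂ (Φ a)).differentiable.comp h1
  have hF0 : ‖F 0‖ = ‖Φ a‖ ^ 2 := by
    simp [hFdef]
  have hF0' : F 0 ≠ 0 := by
    rw [← norm_pos_iff, hF0]; positivity
  have hint : CircleIntegrable (fun z => Real.log ‖F z‖) 0 1 :=
    MeromorphicOn.circleIntegrable_log_norm
      (fun z _ => (hF.analyticAt z).meromorphicAt)
  have hint' : CircleIntegrable (fun z => Real.log ‖F z‖ - Real.log ‖Φ a‖) 0 1 :=
    hint.sub (circleIntegrable_const _ _ _)
  have havg : Real.circleAverage (fun z => Real.log ‖F z‖ - Real.log ‖Φ a‖) 0 1 =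
      Real.circleAverage (fun z => Real.log ‖F z‖) 0 1 - Real.log ‖Φ a‖ := by
    rw [Real.circleAverage_fun_sub hint (circleIntegrable_const _ _ _), Real.circleAverage_const]
  have hle := log_norm_le_circleAverage hF hF0'
  rw [hF0, Real.log_pow] at hle
  push_cast at hle
  calc logNorm Φ a = ((Real.log ‖Φ a‖ : ℝ) : EReal) := logNorm_of_ne h0
    _ ≤ ((Real.circleAverage (fun z => Real.log ‖F z‖ - Real.log ‖Φ a‖) 0 1 : ℝ) : EReal) := by
      rw [havg]; exact EReal.coe_le_coe_iff.2 (by linarith)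
    _ ≤ circleMean (logNorm Φ) a b := by
      refine circleAverage_le_circleMean hint' ?_
      filter_upwards [ae_circleMap_ne_zero hF hF0'] with θ hθ
      have hne : Φ (a + circleMap 0 1 θ • b) ≠ 0 := fun h => hθ (by simp [hFdef, h])
      rw [logNorm_of_ne hne]
      refine EReal.coe_le_coe_iff.2 ?_
      have hnorm : ‖F (circleMap 0 1 θ)‖ ≤ ‖Φ a‖ * ‖Φ (a + circleMap 0 1 θ • b)‖ :=
        norm_inner_le_norm _ _
      have h1 := Real.log_le_log (norm_pos_iff.2 hθ) hnorm
      rw [Real.log_mul hN.ne' (norm_ne_zero_iff.2 hne)] at h1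
      linarith

lemma isPSH_logNorm {n m : ℕ} {Φ : Cn n → Cn m} (hΦ : Differentiable ℂ Φ)
    (h : ∃ z, Φ z ≠ 0) : IsPSH (logNorm Φ) Set.univ where
  lt_top z _ := logNorm_lt_top Φ z
  usc := ((continuous_logNorm hΦ.continuous).upperSemicontinuous).upperSemicontinuousOn _
  submean a b _ := logNorm_submean hΦ a b
  ne_bot x _ := by
    obtain ⟨z, hz⟩ := h
    refine ⟨z, ?_, ?_⟩
    · rw [isPreconnected_univ.connectedComponentIn (Set.mem_univ x)]
      trivial
    · simp [logNorm, hz]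

lemma locallyBddOn_logNorm {n m : ℕ} {Φ : Cn n → Cn m} (hΦ : Continuous Φ) {D : Set (Cn n)}
    (h : ∀ z ∈ D, Φ z ≠ 0) : LocallyBddOn (logNorm Φ) D := by
  intro x hx
  have hc := (continuous_logNorm hΦ).tendsto x
  rw [logNorm_of_ne (h x hx)] at hc
  refine ⟨|Real.log ‖Φ x‖| + 1, ?_⟩
  have h1 := hc.eventually_const_lt (u := ((-(|Real.log ‖Φ x‖| + 1) : ℝ) : EReal))
    (EReal.coe_lt_coe_iff.2 (by linarith [neg_abs_le (Real.log ‖Φ x‖)]))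
  have h2 := hc.eventually_lt_const (u := ((|Real.log ‖Φ x‖| + 1 : ℝ) : EReal))
    (EReal.coe_lt_coe_iff.2 (by linarith [le_abs_self (Real.log ‖Φ x‖)]))
  filter_upwards [h1, h2] with z hz1 hz2 using ⟨hz1.le, hz2.le⟩

/-! ### Logarithmic poles -/

lemma log_enorm_mul_pow {n : ℕ} {c : ℝ} (hc : 0 < c) (k : ℕ) (z p : Cn n) :
    ENNReal.log (ENNReal.ofReal (c * ‖z - p‖ ^ k)) =
      ((k : ℝ) : EReal) * logDist z p + ((Real.log c : ℝ) : EReal) := by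
  rw [ENNReal.ofReal_mul hc.le, ENNReal.log_mul_add, ENNReal.log_ofReal_of_pos hc, add_comm,
    ENNReal.ofReal_pow (norm_nonneg _), ENNReal.log_pow, ofReal_norm, logDist]
  simp

lemma logUpperBoundAt_logNorm {n m : ℕ} {Φ : Cn n → Cn m} {p : Cn n} {k : ℕ} {C : ℝ}
    (hC : 0 < C) (h : ∀ᶠ z in 𝓝 p, ‖Φ z‖ ≤ C * ‖z - p‖ ^ k) :
    LogUpperBoundAt (logNorm Φ) k p := by
  refine ⟨Real.log C, ?_⟩
  filter_upwards [h] with z hz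
  rw [← log_enorm_mul_pow hC, logNorm, ← ofReal_norm]
  exact ENNReal.log_monotone (ENNReal.ofReal_le_ofReal hz)

lemma hasLogPole_logNorm {n m : ℕ} {Φ : Cn n → Cn m} {p : Cn n} {k : ℕ} {c C : ℝ}
    (hc : 0 < c) (hC : 0 < C) (h1 : ∀ᶠ z in 𝓝 p, c * ‖z - p‖ ^ k ≤ ‖Φ z‖)
    (h2 : ∀ᶠ z in 𝓝 p, ‖Φ z‖ ≤ C * ‖z - p‖ ^ k) :
    HasLogPole (logNorm Φ) k p := by
  refine ⟨max (Real.log C) (-Real.log c), ?_⟩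
  filter_upwards [h1, h2] with z hz1 hz2
  constructor
  · have h := ENNReal.log_monotone (ENNReal.ofReal_le_ofReal hz1)
    rw [log_enorm_mul_pow hc, ofReal_norm] at h
    refine le_trans ?_ h
    rw [sub_eq_add_neg, ← EReal.coe_neg]
    refine add_le_add le_rfl (EReal.coe_le_coe_iff.2 ?_)
    linarith [le_max_right (Real.log C) (-Real.log c)]
  · have h := ENNReal.log_monotone (ENNReal.ofReal_le_ofReal hz2)
    rw [log_enorm_mul_pow hC, ofReal_norm] at h
    exact h.trans (add_le_add le_rfl (EReal.coe_le_coe_iff.2 (le_max_left _ _)))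

/-! ### Maximality -/

/-- Pythagoras for the components of (f, g) along (α, β) and along its orthogonal complement. -/
lemma normSq_lagrange (α β f g : ℂ) :
    ‖star α * f + star β * g‖ ^ 2 + ‖α * g - β * f‖ ^ 2 =
      (‖α‖ ^ 2 + ‖β‖ ^ 2) * (‖f‖ ^ 2 + ‖g‖ ^ 2) := by
  simp only [← Complex.normSq_eq_norm_sq, Complex.normSq_apply, Complex.star_def]
  simp
  ring

/-- Through every point outside the zeros of `Φ` there is a complex line along which `log ‖Φ‖` is
harmonic up to an error `o(r²)`. -/
lemma exists_direction {Φ : Cn 2 → Cn 2} (hΦ : Differentiable ℂ Φ) {p : Cn 2} (hp : Φ p ≠ 0) :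
    ∃ b : Cn 2, b ≠ 0 ∧ ∃ F : ℂ → ℂ, Differentiable ℂ F ∧ ‖F 0‖ = ‖Φ p‖ ∧
      ∀ η > 0, ∀ᶠ ζ in 𝓝 (0 : ℂ), F ζ ≠ 0 ∧
        Real.log ‖Φ (p + ζ • b)‖ ≤ Real.log ‖F ζ‖ + η * ‖ζ‖ ^ 2 := by
  have hcomp : ∀ i, Differentiable ℂ fun z => Φ z i := fun i =>
    (differentiable_euclidean.1 hΦ) i
  set α := Φ p 0 with hα
  set β := Φ p 1 with hβ
  set N := ‖Φ p‖ with hN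
  have hNpos : 0 < N := norm_pos_iff.2 hp
  have hsq : ∀ z, ‖Φ z‖ ^ 2 = ‖Φ z 0‖ ^ 2 + ‖Φ z 1‖ ^ 2 := fun z => by
    rw [EuclideanSpace.norm_sq_eq, Fin.sum_univ_two]
  have hNsq : N ^ 2 = ‖α‖ ^ 2 + ‖β‖ ^ 2 := hsq p
  -- T is the differential at p of the component of Φ orthogonal to Φ(p), up to a factor. It maps a
  -- plane to a line, so it kills some direction b.
  set T : Cn 2 →ₗ[ℂ] ℂ := ((α • fderiv ℂ (fun z => Φ z 1) p -
    β • fderiv ℂ (fun z => Φ z 0) p : Cn 2 →L[ℂ] ℂ) : Cn 2 →ₗ[ℂ] ℂ) with hT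
  have hker : T.ker ≠ ⊥ := by
    apply LinearMap.ker_ne_bot_of_finrank_lt
    simp
  obtain ⟨b, hbker, hb0⟩ := (Submodule.ne_bot_iff _).1 hker
  refine ⟨b, hb0, ?_⟩
  have hline : ∀ ζ : ℂ, HasDerivAt (fun ζ : ℂ => p + ζ • b) b ζ := fun ζ => by
    simpa using ((hasDerivAt_id ζ).smul_const b).const_add p
  have hdiff : ∀ i, Differentiable ℂ fun ζ : ℂ => Φ (p + ζ • b) i := fun i =>
    (hcomp i).comp fun ζ => (hline ζ).differentiableAt
  -- F and G are the components of Φ, restricted to the line, along Φ(p) and orthogonal to it. Both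
  -- G and its derivative vanish at 0, so |G|² = o(|ζ|²) only perturbs log‖Φ‖ from log|F| by
  -- o(|ζ|²).
  set F : ℂ → ℂ := fun ζ => (star α * Φ (p + ζ • b) 0 + star β * Φ (p + ζ • b) 1) / N with hF
  set G : ℂ → ℂ := fun ζ => (α * Φ (p + ζ • b) 1 - β * Φ (p + ζ • b) 0) / N with hG
  have hFd : Differentiable ℂ F :=
    (((hdiff 0).const_mul _).add ((hdiff 1).const_mul _)).div_const _
  have hnorm : ∀ ζ, ‖Φ (p + ζ • b)‖ ^ 2 = ‖F ζ‖ ^ 2 + ‖G ζ‖ ^ 2 := fun ζ => by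
    have h := normSq_lagrange α β (Φ (p + ζ • b) 0) (Φ (p + ζ • b) 1)
    rw [← hNsq, ← hsq] at h
    simp only [hF, hG, norm_div, Complex.norm_real, Real.norm_of_nonneg hNpos.le, div_pow]
    rw [← add_div, h]
    field_simp
  have hG0 : G 0 = 0 := by
    simp only [hG, zero_smul, add_zero, ← hα, ← hβ]
    ring
  have hF0 : ‖F 0‖ = N := by
    have h := hnorm 0
    rw [hG0] at h
    simp only [zero_smul, add_zero, norm_zero, ne_eq, OfNat.ofNat_ne_zero, not_false_eq_true,
      zero_pow] at h
    exact ((sq_eq_sq₀ hNpos.le (norm_nonneg _)).1 h).symm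
  have hGd : HasDerivAt G 0 0 := by
    have hd : ∀ i, HasDerivAt (fun ζ : ℂ => Φ (p + ζ • b) i) (fderiv ℂ (fun z => Φ z i) p b) 0 := by
      intro i
      have h1 : HasFDerivAt (fun z => Φ z i) (fderiv ℂ (fun z => Φ z i) p) (p + (0 : ℂ) • b) := by
        simpa using (hcomp i p).hasFDerivAt
      exact h1.comp_hasDerivAt 0 (hline 0)
    have h2 := (((hd 1).const_mul α).sub ((hd 0).const_mul β)).div_const (N : ℂ)
    have h3 : α * fderiv ℂ (fun z => Φ z 1) p b - β * fderiv ℂ (fun z => Φ z 0) p b = 0 := by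
      simpa [hT] using hbker
    rw [h3, zero_div] at h2
    exact h2
  refine ⟨F, hFd, hF0, fun η hη => ?_⟩
  have hFev : ∀ᶠ ζ in 𝓝 (0 : ℂ), N / 2 < ‖F ζ‖ :=
    (hFd.continuous.norm.tendsto 0).eventually_const_lt (by rw [hF0]; linarith)
  -- The constant is chosen so that, with |F| > N/2, the ratio |G|²/|F|² is at most η|ζ|².
  have hGo : ∀ᶠ ζ in 𝓝 (0 : ℂ), ‖G ζ‖ ≤ (Real.sqrt η * N / 2) * ‖ζ‖ := by
    have h := hasDerivAt_iff_isLittleO.1 hGd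
    simp only [hG0, sub_zero, smul_zero] at h
    exact h.def (by positivity)
  filter_upwards [hFev, hGo] with ζ hFζ hGζ
  have hFpos : 0 < ‖F ζ‖ := by linarith
  refine ⟨norm_pos_iff.1 hFpos, ?_⟩
  have hΦpos : 0 < ‖Φ (p + ζ • b)‖ ^ 2 := by rw [hnorm]; positivity
  have hratio : ‖G ζ‖ ^ 2 / ‖F ζ‖ ^ 2 ≤ η * ‖ζ‖ ^ 2 := by
    rw [div_le_iff₀ (by positivity)]
    have h1 : ‖G ζ‖ ^ 2 ≤ ((Real.sqrt η * N / 2) * ‖ζ‖) ^ 2 := by gcongr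
    have h2 : ((Real.sqrt η * N / 2) * ‖ζ‖) ^ 2 = η * ‖ζ‖ ^ 2 * (N / 2) ^ 2 := by
      rw [mul_pow, div_pow, mul_pow, Real.sq_sqrt hη.le]; ring
    rw [h2] at h1
    refine h1.trans ?_
    gcongr
  have hlog : Real.log (‖Φ (p + ζ • b)‖ ^ 2) ≤
      Real.log (‖F ζ‖ ^ 2) + ‖G ζ‖ ^ 2 / ‖F ζ‖ ^ 2 := by
    have h1 : ‖Φ (p + ζ • b)‖ ^ 2 = ‖F ζ‖ ^ 2 * (1 + ‖G ζ‖ ^ 2 / ‖F ζ‖ ^ 2) := by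
      rw [hnorm]; field_simp
    rw [h1, Real.log_mul (by positivity) (by positivity)]
    have := Real.log_le_sub_one_of_pos (x := 1 + ‖G ζ‖ ^ 2 / ‖F ζ‖ ^ 2) (by positivity)
    linarith
  rw [Real.log_pow, Real.log_pow] at hlog
  push_cast at hlog
  have hnn : 0 ≤ η * ‖ζ‖ ^ 2 := by positivity
  linarith

/-- If v exceeded `log ‖Φ‖` somewhere, v + ε‖z‖² - log‖Φ‖ would have an interior maximum p. On a
small disc through p in the direction of `exists_direction`, v would then be bounded by a harmonic
function minus a positive multiple of the squared radius, against the submean inequality. -/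
theorem isMaximalOn_logNorm {Φ : Cn 2 → Cn 2} (hΦ : Differentiable ℂ Φ) {D : Set (Cn 2)}
    (hD : ∀ z ∈ D, Φ z ≠ 0) : IsMaximalOn (logNorm Φ) D := by
  intro G v hGo hGc hGD hvusc hv hfr z0 hz0
  by_contra! hlt
  set φ : Cn 2 → ℝ := fun z => Real.log ‖Φ z‖ with hφ
  have hΦne : ∀ z ∈ closure G, Φ z ≠ 0 := fun z hz => hD z (hGD hz)
  have huφ : ∀ z ∈ closure G, logNorm Φ z = ((φ z : ℝ) : EReal) := fun z hz =>
    logNorm_of_ne (hΦne z hz)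
  have hφc : ContinuousOn φ (closure G) :=
    hΦ.continuous.norm.continuousOn.log fun z hz => norm_ne_zero_iff.2 (hΦne z hz)
  have hreal : ∀ z ∈ G, v z ≠ ⊥ → ∃ s : ℝ, v z = (s : EReal) := fun z hz hbot =>
    ⟨(v z).toReal, (EReal.coe_toReal (hv.lt_top z hz).ne hbot).symm⟩
  have hvtop : ∀ z ∈ closure G, v z ≠ ⊤ := by
    intro z hz
    by_cases hzG : z ∈ G
    · exact (hv.lt_top z hzG).ne
    · have hzf : z ∈ frontier G := by rw [hGo.frontier_eq]; exact ⟨hz, hzG⟩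
      exact ((hfr z hzf).trans_lt (logNorm_lt_top Φ z)).ne
  obtain ⟨s0, hs0⟩ := hreal z0 hz0 (ne_bot_of_gt hlt)
  have hz0c := subset_closure hz0
  rw [huφ z0 hz0c, hs0, EReal.coe_lt_coe_iff] at hlt
  obtain ⟨R, hRpos, hR⟩ : ∃ R > 0, ∀ z ∈ closure G, ‖z‖ ^ 2 ≤ R := by
    obtain ⟨B, hB⟩ := hGc.isBounded.exists_norm_le
    refine ⟨B ^ 2 + 1, by positivity, fun z hz => ?_⟩
    have := pow_le_pow_left₀ (norm_nonneg z) (hB z hz) 2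
    linarith
  set δ := s0 - φ z0 with hδ
  have hδpos : 0 < δ := by linarith
  -- Keeps ε‖z‖² below δ on the closure of G, so the maximum is not attained on the frontier, where
  -- v ≤ log‖Φ‖.
  set ε := δ / (2 * R) with hε
  have hεpos : 0 < ε := by positivity
  have hεR : ε * R < δ := by
    rw [hε]; field_simp; linarith
  set k : Cn 2 → ℝ := fun z => ε * ‖z‖ ^ 2 - φ z with hk
  have hkc : ContinuousOn k (closure G) := by
    refine ContinuousOn.sub (Continuous.continuousOn (by fun_prop)) hφc
  have hwusc : UpperSemicontinuousOn (fun z => v z + ((k z : ℝ) : EReal)) (closure G) := by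
    refine UpperSemicontinuousOn.add' hvusc
      ((continuous_coe_real_ereal.comp_continuousOn hkc).upperSemicontinuousOn) ?_
    intro z hz
    exact EReal.continuousAt_add (Or.inl (hvtop z hz)) (Or.inr (EReal.coe_ne_top _))
  obtain ⟨p, hpc, hpmax⟩ := hwusc.exists_isMaxOn ⟨z0, hz0c⟩ hGc
  have hmax : ∀ z ∈ closure G, v z + ((k z : ℝ) : EReal) ≤ v p + ((k p : ℝ) : EReal) :=
    fun z hz => hpmax hz
  have hpδ : ((δ : ℝ) : EReal) ≤ v p + ((k p : ℝ) : EReal) := by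
    refine le_trans ?_ (hmax z0 hz0c)
    rw [hs0, ← EReal.coe_add, EReal.coe_le_coe_iff]
    have : 0 ≤ ε * ‖z0‖ ^ 2 := by positivity
    simp only [hk]; linarith
  have hpG : p ∈ G := by
    by_contra hpG
    have hpf : p ∈ frontier G := by rw [hGo.frontier_eq]; exact ⟨hpc, hpG⟩
    have h1 := hfr p hpf
    rw [huφ p hpc] at h1
    have h2 := hpδ.trans (add_le_add_left h1 _)
    rw [← EReal.coe_add, EReal.coe_le_coe_iff] at h2
    have h3 : ε * ‖p‖ ^ 2 ≤ ε * R := by gcongr; exact hR p hpc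
    simp only [hk] at h2
    linarith
  obtain ⟨s, hs⟩ := hreal p hpG (by
    intro h; rw [h, EReal.bot_add] at hpδ; exact absurd hpδ (by simp))
  have hvle : ∀ z ∈ closure G, v z ≤ ((s + k p - k z : ℝ) : EReal) := by
    intro z hz
    have h := hmax z hz
    rw [hs, ← EReal.coe_add] at h
    rw [EReal.coe_sub]
    exact EReal.le_sub_iff_add_le (Or.inl (EReal.coe_ne_bot _)) (Or.inl (EReal.coe_ne_top _)) |>.2 h
  obtain ⟨b, hb0, F, hFd, hF0, hFlog⟩ := exists_direction hΦ (hΦne p hpc)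
  have hbpos : 0 < ‖b‖ := norm_pos_iff.2 hb0
  -- The exponential absorbs the term 2ε Re⟨p, ζb⟩ of ε‖p + ζb‖², which is harmonic in ζ.
  set H : ℂ → ℂ := fun ζ => F ζ * Complex.exp (-(2 * ε * inner ℂ p b) * ζ) with hH
  have hHd : Differentiable ℂ H := by
    refine hFd.mul (Differentiable.cexp ?_)
    fun_prop
  -- The error in `exists_direction` is taken to be half of ε‖b‖²|ζ|², so that half of the strictly
  -- subharmonic term survives.
  obtain ⟨ρ, hρpos, hρ⟩ : ∃ ρ > 0, ∀ ζ : ℂ, ‖ζ‖ ≤ ρ → p + ζ • b ∈ G ∧ F ζ ≠ 0 ∧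
      Real.log ‖Φ (p + ζ • b)‖ ≤ Real.log ‖F ζ‖ + (ε * ‖b‖ ^ 2 / 2) * ‖ζ‖ ^ 2 := by
    have h1 : ∀ᶠ ζ in 𝓝 (0 : ℂ), p + ζ • b ∈ G := by
      have hc : Continuous fun ζ : ℂ => p + ζ • b := by fun_prop
      exact hc.tendsto' 0 p (by simp) (hGo.mem_nhds hpG)
    obtain ⟨r, hr, hball⟩ := Metric.eventually_nhds_iff_ball.1
      (h1.and (hFlog (ε * ‖b‖ ^ 2 / 2) (by positivity)))
    refine ⟨r / 2, by positivity, fun ζ hζ => hball ζ ?_⟩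
    simp only [mem_ball_zero_iff]
    linarith
  -- On the circle v is at most c + log|K|, whose average is c + φ(p) = s - ε‖b‖²ρ²/2 < v(p).
  set c : ℝ := s - φ p - ε * ‖b‖ ^ 2 * ρ ^ 2 / 2 with hc
  have hHne : ∀ ζ : ℂ, ‖ζ‖ ≤ 1 → H (ρ * ζ) ≠ 0 := by
    intro ζ hζ
    refine mul_ne_zero (hρ _ ?_).2.1 (Complex.exp_ne_zero _)
    rw [norm_mul, Complex.norm_real, Real.norm_of_nonneg hρpos.le]
    nlinarith
  set K : ℂ → ℂ := fun ζ => H (ρ * ζ) with hK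
  have hKd : Differentiable ℂ K := hHd.comp (by fun_prop)
  have hKan : AnalyticOnNhd ℂ K (Metric.closedBall 0 |1|) := fun z _ => hKd.analyticAt z
  have hKavg : Real.circleAverage (fun ζ => Real.log ‖K ζ‖) 0 1 = φ p := by
    have := hKan.circleAverage_log_norm_of_ne_zero (fun ζ hζ => hHne ζ (by simpa using hζ))
    rw [this]
    simp [hK, hH, hF0, hφ]
  have hKint : CircleIntegrable (fun ζ => Real.log ‖K ζ‖) 0 1 :=
    MeromorphicOn.circleIntegrable_log_norm fun z _ => (hKd.analyticAt z).meromorphicAt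
  have hint : CircleIntegrable (fun ζ => c + Real.log ‖K ζ‖) 0 1 :=
    (circleIntegrable_const _ _ _).add hKint
  have hsub : v p ≤ circleMean v p ((ρ : ℂ) • b) := by
    refine hv.submean _ _ fun ζ hζ => ?_
    rw [smul_smul]
    refine (hρ _ ?_).1
    rw [norm_mul, Complex.norm_real, Real.norm_of_nonneg hρpos.le]
    nlinarith
  have hmean := hsub.trans (circleMean_le_circleAverage hint ?_)
  · rw [Real.circleAverage_fun_add (circleIntegrable_const _ _ _) hKint,
      Real.circleAverage_const, hKavg, hs, EReal.coe_le_coe_iff] at hmean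
    have : 0 < ε * ‖b‖ ^ 2 * ρ ^ 2 / 2 := by positivity
    linarith
  · intro θ
    set ζ := circleMap 0 1 θ with hζ
    have hζ1 : ‖ζ‖ = 1 := by simp [hζ]
    have hnρ : ‖(ρ : ℂ) * ζ‖ = ρ := by
      rw [norm_mul, hζ1, Complex.norm_real, Real.norm_of_nonneg hρpos.le, mul_one]
    obtain ⟨hGmem, hFne, hlog⟩ := hρ ((ρ : ℂ) * ζ) hnρ.le
    rw [smul_smul, mul_comm ζ]
    refine (hvle _ (subset_closure hGmem)).trans (EReal.coe_le_coe_iff.2 ?_)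
    have hKlog : Real.log ‖K ζ‖ = Real.log ‖F (ρ * ζ)‖ -
        2 * ε * (inner ℂ p (((ρ : ℂ) * ζ) • b)).re := by
      simp only [hK, hH]
      rw [norm_mul, Real.log_mul (norm_ne_zero_iff.2 hFne)
        (norm_ne_zero_iff.2 (Complex.exp_ne_zero _)), Complex.norm_exp, Real.log_exp,
        inner_smul_right]
      have : (-(2 * (ε : ℂ) * inner ℂ p b) * ((ρ : ℂ) * ζ)) =
          ((-(2 * ε) : ℝ) : ℂ) * ((ρ : ℂ) * ζ * inner ℂ p b) := by
        push_cast; ring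
      rw [this, Complex.re_ofReal_mul]
      ring
    have hexp : ‖p + ((ρ : ℂ) * ζ) • b‖ ^ 2 = ‖p‖ ^ 2 +
        2 * (inner ℂ p (((ρ : ℂ) * ζ) • b)).re + ρ ^ 2 * ‖b‖ ^ 2 := by
      rw [norm_add_sq (𝕜 := ℂ), norm_smul, hnρ, mul_pow]
      rfl
    rw [hnρ] at hlog
    rw [hKlog]
    simp only [hk, hφ, hexp, hc] at *
    nlinarith [hlog]

/-! ### Growth of `log ‖Φ‖` -/

lemma coe_div_log (x : ℝ) (z : ℝ) :
    ((x : ℝ) : EReal) / ((z : ℝ) : EReal) = ((x / z : ℝ) : EReal) := (EReal.coe_div x z).symm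

lemma growth_logNorm_le {n m : ℕ} {Φ : Cn n → Cn m} {d : ℕ} {C : ℝ} (hC : 0 < C)
    (h : ∀ z, 1 ≤ ‖z‖ → ‖Φ z‖ ≤ C * ‖z‖ ^ d) : growth (logNorm Φ) ≤ d := by
  have hnorm : Tendsto (fun z : Cn n => Real.log ‖z‖) (Bornology.cobounded (Cn n)) atTop :=
    Real.tendsto_log_atTop.comp tendsto_norm_cobounded_atTop
  have hlim : Tendsto (fun z : Cn n => (((d : ℝ) + Real.log C / Real.log ‖z‖ : ℝ) : EReal))
      (Bornology.cobounded (Cn n)) (𝓝 (((d : ℝ) + 0 : ℝ) : EReal)) :=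
    (continuous_coe_real_ereal.tendsto _).comp
      (tendsto_const_nhds.add (hnorm.const_div_atTop _))
  have hd : (((d : ℝ) + 0 : ℝ) : EReal) = (d : EReal) := by simp
  rw [hd] at hlim
  -- Happens only for n = 0; the limsup along the trivial filter is -∞.
  by_cases hbot : (Bornology.cobounded (Cn n)) = ⊥
  · rw [growth, hbot]; simp
  have : (Bornology.cobounded (Cn n)).NeBot := ⟨hbot⟩
  rw [← hlim.limsup_eq]
  refine limsup_le_limsup ?_
  filter_upwards [hnorm.eventually_gt_atTop 0,
    tendsto_norm_cobounded_atTop.eventually_ge_atTop 1] with z hz hz1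
  by_cases h0 : Φ z = 0
  · have : logNorm Φ z = ⊥ := by simp [logNorm, h0]
    rw [this, EReal.bot_div_of_pos_ne_top (by exact_mod_cast hz) (EReal.coe_ne_top _)]
    exact bot_le
  · rw [logNorm_of_ne h0, coe_div_log, EReal.coe_le_coe_iff]
    have hzpos : 0 < ‖z‖ := by linarith
    have h1 := Real.log_le_log (norm_pos_iff.2 h0) (h z hz1)
    rw [Real.log_mul hC.ne' (by positivity), Real.log_pow] at h1
    rw [div_le_iff₀ hz, add_mul, div_mul_cancel₀ _ hz.ne']
    linarith

/-- A limsup at infinity is at least the limsup along a single ray, where the quotient is at least d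
+ O(1/log t). -/
lemma le_growth_logNorm {n m : ℕ} {Φ : Cn n → Cn m} {d : ℕ} {c : ℝ} (hc : 0 < c) {b : Cn n}
    (hb : b ≠ 0) (h : ∀ᶠ t : ℝ in atTop, c * t ^ d ≤ ‖Φ ((t : ℂ) • b)‖) :
    (d : EReal) ≤ growth (logNorm Φ) := by
  have hbpos : 0 < ‖b‖ := norm_pos_iff.2 hb
  have hnt : ∀ t : ℝ, 0 ≤ t → ‖(t : ℂ) • b‖ = t * ‖b‖ := fun t ht => by
    rw [norm_smul, Complex.norm_real, Real.norm_of_nonneg ht]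
  have hT : Tendsto (fun t : ℝ => (t : ℂ) • b) atTop (Bornology.cobounded (Cn n)) := by
    rw [← tendsto_norm_atTop_iff_cobounded]
    refine (tendsto_id.atTop_mul_const hbpos).congr' ?_
    filter_upwards [eventually_ge_atTop 0] with t ht using (hnt t ht).symm
  have hnorm : Tendsto (fun t : ℝ => Real.log ‖(t : ℂ) • b‖) atTop atTop :=
    Real.tendsto_log_atTop.comp (tendsto_norm_cobounded_atTop.comp hT)
  set e : ℝ := Real.log c - d * Real.log ‖b‖ with he
  have hlim : Tendsto (fun t : ℝ => (((d : ℝ) + e / Real.log ‖(t : ℂ) • b‖ : ℝ) : EReal))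
      atTop (𝓝 (((d : ℝ) + 0 : ℝ) : EReal)) :=
    (continuous_coe_real_ereal.tendsto _).comp
      (tendsto_const_nhds.add (hnorm.const_div_atTop _))
  have hd : (((d : ℝ) + 0 : ℝ) : EReal) = (d : EReal) := by simp
  rw [hd] at hlim
  rw [← hlim.limsup_eq]
  refine le_trans ?_ (limsup_le_limsup_of_le (f := map (fun t : ℝ => (t : ℂ) • b) atTop) hT)
  rw [Filter.limsup, Filter.limsup, Filter.map_map]
  change limsup _ _ ≤ limsup _ _
  refine limsup_le_limsup ?_
  filter_upwards [hnorm.eventually_gt_atTop 0, eventually_gt_atTop 0, h] with t ht ht0 htc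
  have h0 : Φ ((t : ℂ) • b) ≠ 0 := by
    rw [← norm_pos_iff]; exact lt_of_lt_of_le (by positivity) htc
  simp only [Function.comp_apply]
  rw [logNorm_of_ne h0, coe_div_log, EReal.coe_le_coe_iff]
  have h1 := Real.log_le_log (by positivity) htc
  rw [Real.log_mul hc.ne' (by positivity), Real.log_pow] at h1
  rw [le_div_iff₀ ht, add_mul, div_mul_cancel₀ _ ht.ne', hnt t ht0.le,
    Real.log_mul ht0.ne' hbpos.ne', he]
  linarith

/-! ### Polynomial maps -/

/-- The value of a polynomial at a point of `ℂ²`. -/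
noncomputable def pev (P : MvPolynomial (Fin 2) ℂ) (z : Cn 2) : ℂ :=
  MvPolynomial.eval (fun i => z i) P

@[simp] lemma pev_mul (P Q : MvPolynomial (Fin 2) ℂ) (z : Cn 2) :
    pev (P * Q) z = pev P z * pev Q z := by simp [pev]
@[simp] lemma pev_add (P Q : MvPolynomial (Fin 2) ℂ) (z : Cn 2) :
    pev (P + Q) z = pev P z + pev Q z := by simp [pev]
@[simp] lemma pev_sub (P Q : MvPolynomial (Fin 2) ℂ) (z : Cn 2) :
    pev (P - Q) z = pev P z - pev Q z := by simp [pev]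
@[simp] lemma pev_C (c : ℂ) (z : Cn 2) : pev (MvPolynomial.C c) z = c := by simp [pev]
@[simp] lemma pev_X (i : Fin 2) (z : Cn 2) : pev (MvPolynomial.X i) z = z i := by simp [pev]
@[simp] lemma pev_zero (z : Cn 2) : pev 0 z = 0 := by simp [pev]

lemma eq_zero_of_pev (P : MvPolynomial (Fin 2) ℂ) (h : ∀ z, pev P z = 0) : P = 0 := by
  refine MvPolynomial.funext fun x => ?_
  simpa [pev] using h (WithLp.toLp 2 x)

lemma exists_pev_ne_zero {P : MvPolynomial (Fin 2) ℂ} (h : P ≠ 0) : ∃ z, pev P z ≠ 0 := by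
  by_contra! hz
  exact h (eq_zero_of_pev P hz)

lemma differentiable_pev (P : MvPolynomial (Fin 2) ℂ) : Differentiable ℂ (pev P) := by
  induction P using MvPolynomial.induction_on with
  | C a =>
    have : pev (MvPolynomial.C a) = fun _ => a := funext fun z => pev_C a z
    rw [this]; exact differentiable_const a
  | add p q hp hq =>
    have : pev (p + q) = fun z => pev p z + pev q z := funext fun z => pev_add p q z
    rw [this]; exact hp.add hq
  | mul_X p i hp =>
    have : pev (p * MvPolynomial.X i) = fun z => pev p z * z i := funext fun z => by simp
    rw [this]
    exact hp.mul (EuclideanSpace.proj (𝕜 := ℂ) i).differentiable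

lemma norm_pev_le (P : MvPolynomial (Fin 2) ℂ) {d : ℕ} (hd : P.totalDegree ≤ d) :
    ∃ C > 0, ∀ z, 1 ≤ ‖z‖ → ‖pev P z‖ ≤ C * ‖z‖ ^ d := by
  -- The summand 1 only makes the constant positive when P = 0.
  refine ⟨∑ s ∈ P.support, ‖P.coeff s‖ + 1, by positivity, fun z hz => ?_⟩
  have hterm : ∀ s ∈ P.support, ‖P.coeff s * ∏ i, z i ^ s i‖ ≤ ‖P.coeff s‖ * ‖z‖ ^ d := by
    intro s hs
    rw [norm_mul]
    gcongr
    rw [norm_prod, Fin.prod_univ_two, norm_pow, norm_pow]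
    have hs' : s 0 + s 1 ≤ d := by
      have := (MvPolynomial.le_totalDegree hs).trans hd
      rwa [Finsupp.sum_fintype _ _ (by simp), Fin.sum_univ_two] at this
    calc ‖z 0‖ ^ s 0 * ‖z 1‖ ^ s 1 ≤ ‖z‖ ^ s 0 * ‖z‖ ^ s 1 := by
          gcongr <;> exact PiLp.norm_apply_le z _
      _ = ‖z‖ ^ (s 0 + s 1) := (pow_add _ _ _).symm
      _ ≤ ‖z‖ ^ d := pow_le_pow_right₀ hz hs'
  rw [pev, MvPolynomial.eval_eq']
  calc _ ≤ ∑ s ∈ P.support, ‖P.coeff s * ∏ i, z i ^ s i‖ := norm_sum_le _ _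
    _ ≤ ∑ s ∈ P.support, ‖P.coeff s‖ * ‖z‖ ^ d := Finset.sum_le_sum hterm
    _ = (∑ s ∈ P.support, ‖P.coeff s‖) * ‖z‖ ^ d := (Finset.sum_mul _ _ _).symm
    _ ≤ _ := by gcongr; linarith

/-- The restriction of a polynomial to the complex line `t ↦ a + t b`. -/
noncomputable def restrictLine (P : MvPolynomial (Fin 2) ℂ) (a b : Cn 2) : Polynomial ℂ :=
  MvPolynomial.aeval (fun i => Polynomial.C (a i) + Polynomial.C (b i) * Polynomial.X) P

lemma eval_restrictLine (P : MvPolynomial (Fin 2) ℂ) (a b : Cn 2) (t : ℂ) :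
    (restrictLine P a b).eval t = pev P (a + t • b) := by
  induction P using MvPolynomial.induction_on with
  | C c => rw [pev_C, restrictLine, MvPolynomial.aeval_C, Polynomial.algebraMap_eq,
      Polynomial.eval_C]
  | add p q hp hq =>
    rw [pev_add, ← hp, ← hq, restrictLine, map_add, Polynomial.eval_add, restrictLine, restrictLine]
  | mul_X p i hp =>
    rw [pev_mul, ← hp, restrictLine, map_mul, Polynomial.eval_mul, restrictLine]
    rw [MvPolynomial.aeval_X, pev_X, Polynomial.eval_add, Polynomial.eval_mul, Polynomial.eval_C,
      Polynomial.eval_C, Polynomial.eval_X, PiLp.add_apply, PiLp.smul_apply, smul_eq_mul,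
      mul_comm t]

lemma natDegree_restrictLine_le {P : MvPolynomial (Fin 2) ℂ} {d : ℕ} (hd : P.totalDegree ≤ d)
    (a b : Cn 2) : (restrictLine P a b).natDegree ≤ d := by
  have := MvPolynomial.aeval_natDegree_le P hd
    (fun i => Polynomial.C (a i) + Polynomial.C (b i) * Polynomial.X) (n := 1)
    (fun i => by compute_degree)
  rwa [mul_one] at this

/-- Choose b where the top homogeneous part T does not vanish: it scales like t^d along the ray and
dominates the rest. -/
lemma exists_growth_direction {P : MvPolynomial (Fin 2) ℂ} {d : ℕ} (hd : P.totalDegree = d)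
    (hd0 : 0 < d) :
    ∃ b : Cn 2, b ≠ 0 ∧ ∃ c > 0, ∀ᶠ t : ℝ in atTop, c * t ^ d ≤ ‖pev P ((t : ℂ) • b)‖ := by
  have hP : P ≠ 0 := by rintro rfl; simp at hd; omega
  obtain ⟨e, rfl⟩ : ∃ e, d = e + 1 := ⟨d - 1, by omega⟩
  set T := P.homogeneousComponent (e + 1) with hT
  have hThom : T.IsHomogeneous (e + 1) := MvPolynomial.homogeneousComponent_isHomogeneous _ _
  have hsum : P = ∑ i ∈ Finset.range (e + 1), P.homogeneousComponent i + T := by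
    conv_lhs => rw [← MvPolynomial.sum_homogeneousComponent P, hd, Finset.sum_range_succ]
  set Q := ∑ i ∈ Finset.range (e + 1), P.homogeneousComponent i with hQ
  have hQd : Q.totalDegree ≤ e := by
    refine MvPolynomial.totalDegree_finsetSum_le fun i hi => ?_
    have := Finset.mem_range.1 hi
    exact (MvPolynomial.homogeneousComponent_isHomogeneous i P).totalDegree_le.trans (by omega)
  have hT0 : T ≠ 0 := by
    intro h0
    rw [h0, add_zero] at hsum
    rw [hsum] at hd
    omega
  obtain ⟨b, hb⟩ := exists_pev_ne_zero hT0
  have hscale : ∀ t : ℂ, pev T (t • b) = t ^ (e + 1) * pev T b := by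
    intro t
    rw [pev, pev, MvPolynomial.eval_eq', MvPolynomial.eval_eq', Finset.mul_sum]
    refine Finset.sum_congr rfl fun s hs => ?_
    have hs' : s 0 + s 1 = e + 1 := by
      have := hThom (MvPolynomial.mem_support_iff.1 hs)
      rwa [Finsupp.weight_apply, Finsupp.sum_fintype _ _ (by simp), Fin.sum_univ_two,
        Pi.one_apply, Pi.one_apply, smul_eq_mul, smul_eq_mul, mul_one, mul_one] at this
    rw [Fin.prod_univ_two, Fin.prod_univ_two, ← hs']
    simp only [PiLp.smul_apply, smul_eq_mul]
    ring
  have hb0 : b ≠ 0 := by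
    rintro rfl
    have := hscale 0
    simp at this
    exact hb this
  have hbpos : 0 < ‖b‖ := norm_pos_iff.2 hb0
  have hTpos : 0 < ‖pev T b‖ := norm_pos_iff.2 hb
  obtain ⟨C, hC, hbound⟩ := norm_pev_le Q hQd
  refine ⟨b, hb0, ‖pev T b‖ / 2, by positivity, ?_⟩
  -- The first threshold gives ‖tb‖ ≥ 1, as the bound on Q requires; the last makes Q at most half
  -- of T.
  filter_upwards [eventually_ge_atTop (‖b‖⁻¹), eventually_gt_atTop 0,
    eventually_ge_atTop (2 * C * ‖b‖ ^ e / ‖pev T b‖)] with t ht1 ht0 ht2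
  have hnt : ‖(t : ℂ) • b‖ = t * ‖b‖ := by
    rw [norm_smul, Complex.norm_real, Real.norm_of_nonneg ht0.le]
  have h1 : ‖pev Q ((t : ℂ) • b)‖ ≤ C * (t * ‖b‖) ^ e := by
    rw [← hnt]
    refine hbound _ ?_
    rw [hnt]
    calc 1 = ‖b‖⁻¹ * ‖b‖ := (inv_mul_cancel₀ hbpos.ne').symm
      _ ≤ t * ‖b‖ := by gcongr
  have h2 : ‖pev T ((t : ℂ) • b)‖ = t ^ (e + 1) * ‖pev T b‖ := by
    rw [hscale, norm_mul, norm_pow, Complex.norm_real, Real.norm_of_nonneg ht0.le]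
  have h3 : C * (t * ‖b‖) ^ e ≤ t ^ (e + 1) * (‖pev T b‖ / 2) := by
    rw [div_le_iff₀ hTpos] at ht2
    rw [mul_pow, pow_succ]
    have : 0 < t ^ e := by positivity
    nlinarith
  have h4 : ‖pev T ((t : ℂ) • b)‖ ≤ ‖pev P ((t : ℂ) • b)‖ + ‖pev Q ((t : ℂ) • b)‖ := by
    have : pev T ((t : ℂ) • b) = pev P ((t : ℂ) • b) - pev Q ((t : ℂ) • b) := by
      rw [hsum, pev_add]; ring
    rw [this]
    exact norm_sub_le _ _
  rw [h2] at h4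
  linarith

/-- The polynomial map of `ℂ²` with components `P` and `Q`. -/
noncomputable def polyMap (P Q : MvPolynomial (Fin 2) ℂ) (z : Cn 2) : Cn 2 :=
  !₂[pev P z, pev Q z]

lemma differentiable_polyMap (P Q : MvPolynomial (Fin 2) ℂ) :
    Differentiable ℂ (polyMap P Q) := by
  refine differentiable_euclidean.2 fun i => ?_
  fin_cases i
  · exact differentiable_pev P
  · exact differentiable_pev Q

lemma polyMap_eq_zero {P Q : MvPolynomial (Fin 2) ℂ} {z : Cn 2} :
    polyMap P Q z = 0 ↔ pev P z = 0 ∧ pev Q z = 0 := by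
  constructor
  · intro h
    exact ⟨by simpa [polyMap] using congrArg (fun v : Cn 2 => v 0) h,
      by simpa [polyMap] using congrArg (fun v : Cn 2 => v 1) h⟩
  · rintro ⟨h1, h2⟩
    ext i
    fin_cases i <;> simp [polyMap, h1, h2]

lemma norm_polyMap_le (P Q : MvPolynomial (Fin 2) ℂ) (z : Cn 2) :
    ‖polyMap P Q z‖ ≤ ‖pev P z‖ + ‖pev Q z‖ := by
  rw [EuclideanSpace.norm_eq, Fin.sum_univ_two]
  refine Real.sqrt_le_iff.2 ⟨by positivity, ?_⟩
  simp only [polyMap, PiLp.toLp_apply, Matrix.cons_val_zero, Matrix.cons_val_one]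
  nlinarith [norm_nonneg (pev P z), norm_nonneg (pev Q z)]

lemma norm_left_le_polyMap (P Q : MvPolynomial (Fin 2) ℂ) (z : Cn 2) :
    ‖pev P z‖ ≤ ‖polyMap P Q z‖ := by
  simpa [polyMap] using PiLp.norm_apply_le (polyMap P Q z) 0

lemma norm_right_le_polyMap (P Q : MvPolynomial (Fin 2) ℂ) (z : Cn 2) :
    ‖pev Q z‖ ≤ ‖polyMap P Q z‖ := by
  simpa [polyMap] using PiLp.norm_apply_le (polyMap P Q z) 1

theorem growth_logNorm_polyMap {P Q : MvPolynomial (Fin 2) ℂ} {d : ℕ} (hd0 : 0 < d)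
    (hP : P.totalDegree ≤ d) (hQ : Q.totalDegree ≤ d)
    (h : P.totalDegree = d ∨ Q.totalDegree = d) : growth (logNorm (polyMap P Q)) = d := by
  refine le_antisymm ?_ ?_
  · obtain ⟨C1, hC1, h1⟩ := norm_pev_le P hP
    obtain ⟨C2, hC2, h2⟩ := norm_pev_le Q hQ
    refine growth_logNorm_le (C := C1 + C2) (by positivity) fun z hz => ?_
    rw [add_mul]
    exact (norm_polyMap_le P Q z).trans (add_le_add (h1 z hz) (h2 z hz))
  · rcases h with h | h
    · obtain ⟨b, hb, c, hc, hev⟩ := exists_growth_direction h hd0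
      refine le_growth_logNorm hc hb ?_
      filter_upwards [hev] with t ht using ht.trans (norm_left_le_polyMap P Q _)
    · obtain ⟨b, hb, c, hc, hev⟩ := exists_growth_direction h hd0
      refine le_growth_logNorm hc hb ?_
      filter_upwards [hev] with t ht using ht.trans (norm_right_le_polyMap P Q _)

/-! ### Common zeros of plane curves -/

/-- The maximal ideal of polynomials vanishing at a point. -/
noncomputable def pointIdeal (z : Cn 2) : Ideal (MvPolynomial (Fin 2) ℂ) :=
  RingHom.ker (MvPolynomial.eval (fun i => z i))

lemma mem_pointIdeal {z : Cn 2} {P : MvPolynomial (Fin 2) ℂ} : P ∈ pointIdeal z ↔ pev P z = 0 :=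
  Iff.rfl

lemma pointIdeal_isMaximal (z : Cn 2) : (pointIdeal z).IsMaximal :=
  RingHom.ker_isMaximal_of_surjective _ fun c => ⟨MvPolynomial.C c, by simp⟩

lemma pointIdeal_injective : Function.Injective pointIdeal := by
  intro z w h
  ext i
  have h1 : MvPolynomial.X i - MvPolynomial.C (z i) ∈ pointIdeal z := by
    simp [mem_pointIdeal]
  rw [h, mem_pointIdeal, pev_sub, pev_X, pev_C, sub_eq_zero] at h1
  exact h1.symm

/-- Otherwise 0 < (P) < J < M would be a chain of primes of length 3 in a ring of Krull dimension 2.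
-/
lemma isMaximal_of_two_mem {P Q : MvPolynomial (Fin 2) ℂ} (hP : Irreducible P) (hPQ : ¬ P ∣ Q)
    {J : Ideal (MvPolynomial (Fin 2) ℂ)} [hJ : J.IsPrime] (h1 : P ∈ J) (h2 : Q ∈ J) :
    J.IsMaximal := by
  by_contra hmax
  obtain ⟨M, hM, hJM⟩ := Ideal.exists_le_maximal J hJ.ne_top
  have hlt : J < M := lt_of_le_of_ne hJM (by rintro rfl; exact hmax hM)
  have hprime : (Ideal.span {P}).IsPrime :=
    (Ideal.span_singleton_prime hP.ne_zero).2 hP.prime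
  have hPJ : Ideal.span {P} < J := by
    refine lt_of_le_of_ne ((Ideal.span_singleton_le_iff_mem _).2 h1) ?_
    rintro rfl
    exact hPQ (Ideal.mem_span_singleton.1 h2)
  have hbot : (⊥ : Ideal (MvPolynomial (Fin 2) ℂ)) < Ideal.span {P} := by
    rw [bot_lt_iff_ne_bot, Ne, Ideal.span_singleton_eq_bot]
    exact hP.ne_zero
  let s : LTSeries (PrimeSpectrum (MvPolynomial (Fin 2) ℂ)) :=
    { length := 3
      toFun := ![⟨⊥, Ideal.isPrime_bot⟩, ⟨_, hprime⟩, ⟨J, hJ⟩, ⟨M, hM.isPrime⟩]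
      step := by
        intro i
        fin_cases i
        · exact hbot
        · exact hPJ
        · exact hlt }
  have hdim : ringKrullDim (MvPolynomial (Fin 2) ℂ) = 2 := by simp
  have hle := Order.LTSeries.length_le_krullDim s
  rw [← ringKrullDim, hdim] at hle
  have : ((3 : ℕ) : WithBot ℕ∞) ≤ ((2 : ℕ) : WithBot ℕ∞) := hle
  norm_cast at this

/-- The maximal ideal of each common zero is a minimal prime over (P, Q), and a Noetherian ring has
only finitely many of these. -/
lemma finite_common_zeros {P Q : MvPolynomial (Fin 2) ℂ} (hP : Irreducible P) (hPQ : ¬ P ∣ Q) :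
    {z | pev P z = 0 ∧ pev Q z = 0}.Finite := by
  have hfin := Ideal.finite_minimalPrimes_of_isNoetherianRing (MvPolynomial (Fin 2) ℂ)
    (Ideal.span {P, Q})
  refine Set.Finite.of_finite_image (f := pointIdeal) (hfin.subset ?_)
    pointIdeal_injective.injOn
  rintro _ ⟨z, ⟨hz1, hz2⟩, rfl⟩
  have hmax := pointIdeal_isMaximal z
  have hle : Ideal.span {P, Q} ≤ pointIdeal z := by
    rw [Ideal.span_le]
    rintro R (rfl | rfl)
    · exact hz1
    · exact hz2
  have hprime := hmax.isPrime
  obtain ⟨J, hJ, hJle⟩ := Ideal.exists_minimalPrimes_le hle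
  have hJp : J.IsPrime := hJ.1.1
  have hJmax : J.IsMaximal := isMaximal_of_two_mem hP hPQ
    (hJ.1.2 (Ideal.subset_span (by simp))) (hJ.1.2 (Ideal.subset_span (by simp)))
  rw [← hJmax.eq_of_le hmax.ne_top hJle]
  exact hJ

/-- Two plane curves with infinitely many common points have a common component. -/
theorem exists_common_factor {P Q : MvPolynomial (Fin 2) ℂ} (hP : P ≠ 0)
    (hinf : ¬ {z | pev P z = 0 ∧ pev Q z = 0}.Finite) :
    ∃ h, Irreducible h ∧ h ∣ P ∧ h ∣ Q := by
  induction P using WfDvdMonoid.induction_on_irreducible with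
  | zero => exact absurd rfl hP
  | unit u hu =>
    refine absurd ?_ hinf
    convert! Set.finite_empty
    ext z
    simp only [Set.mem_ofPred_eq, Set.mem_empty_iff_false, iff_false, not_and]
    intro h
    have := hu.map (MvPolynomial.eval (fun i => z i))
    exact absurd h this.ne_zero
  | mul a i ha hi ih =>
    by_cases hiQ : i ∣ Q
    · exact ⟨i, hi, Dvd.intro _ rfl, hiQ⟩
    -- The irreducible factor i accounts for finitely many common zeros, so infinitely many remain
    -- on the cofactor a.
    · have hainf : ¬ {z | pev a z = 0 ∧ pev Q z = 0}.Finite := by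
        intro hfin
        refine hinf ((hfin.union (finite_common_zeros hi hiQ)).subset ?_)
        rintro z ⟨hz1, hz2⟩
        rw [pev_mul, mul_eq_zero] at hz1
        rcases hz1 with h | h
        · exact Or.inr ⟨h, hz2⟩
        · exact Or.inl ⟨h, hz2⟩
      obtain ⟨h, hh, h1, h2⟩ := ih ha hainf
      exact ⟨h, hh, h1.mul_left _, h2⟩

/-! ### Lines -/

/-- The determinant whose vanishing says that `z` is on the line through `a` and `b`. -/
def cross (a b z : Cn 2) : ℂ := (b 0 - a 0) * (z 1 - a 1) - (b 1 - a 1) * (z 0 - a 0)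

/-- The equation of the line through `a` and `b`. -/
noncomputable def lineP (a b : Cn 2) : MvPolynomial (Fin 2) ℂ :=
  MvPolynomial.C (b 0 - a 0) * (MvPolynomial.X 1 - MvPolynomial.C (a 1)) -
    MvPolynomial.C (b 1 - a 1) * (MvPolynomial.X 0 - MvPolynomial.C (a 0))

@[simp] lemma pev_lineP (a b z : Cn 2) : pev (lineP a b) z = cross a b z := by
  simp [lineP, cross]

@[simp] lemma cross_left (a b : Cn 2) : cross a b a = 0 := by simp [cross]
@[simp] lemma cross_right (a b : Cn 2) : cross a b b = 0 := by simp [cross]; ring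
lemma cross_swap (a b z : Cn 2) : cross b a z = -cross a b z := by simp only [cross]; ring
lemma cross_rotate (a b c : Cn 2) : cross b c a = cross a b c := by simp only [cross]; ring

lemma totalDegree_lineP_le (a b : Cn 2) : (lineP a b).totalDegree ≤ 1 := by
  have h : ∀ (c e : ℂ) (i : Fin 2), (MvPolynomial.C c * (MvPolynomial.X i - MvPolynomial.C e) :
      MvPolynomial (Fin 2) ℂ).totalDegree ≤ 1 := by
    intro c e i
    refine (MvPolynomial.totalDegree_mul _ _).trans ?_
    rw [MvPolynomial.totalDegree_C, zero_add]
    refine (MvPolynomial.totalDegree_sub_C_le _ _).trans ?_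
    rw [MvPolynomial.totalDegree_X]
  exact (MvPolynomial.totalDegree_sub _ _).trans (max_le (h _ _ _) (h _ _ _))

lemma exists_cross_ne_zero {a b : Cn 2} (hab : a ≠ b) : ∃ z, cross a b z ≠ 0 := by
  by_contra! h
  apply hab
  have h0 := h (a + !₂[1, 0])
  have h1 := h (a + !₂[0, 1])
  simp [cross] at h0 h1
  ext i
  fin_cases i
  · exact (sub_eq_zero.1 h1).symm
  · exact sub_eq_zero.1 h0

lemma lineP_ne_zero {a b : Cn 2} (hab : a ≠ b) : lineP a b ≠ 0 := by
  obtain ⟨z, hz⟩ := exists_cross_ne_zero hab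
  intro h
  rw [← pev_lineP, h, pev_zero] at hz
  exact hz rfl

lemma pev_eq_of_totalDegree_eq_zero {P : MvPolynomial (Fin 2) ℂ} (h : P.totalDegree = 0)
    (z w : Cn 2) : pev P z = pev P w := by
  rw [MvPolynomial.totalDegree_eq_zero_iff_eq_C.1 h, pev_C, pev_C]

lemma totalDegree_lineP {a b : Cn 2} (hab : a ≠ b) : (lineP a b).totalDegree = 1 := by
  refine le_antisymm (totalDegree_lineP_le a b) (Nat.one_le_iff_ne_zero.2 fun h => ?_)
  obtain ⟨z, hz⟩ := exists_cross_ne_zero hab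
  apply hz
  rw [← pev_lineP, pev_eq_of_totalDegree_eq_zero h z a, pev_lineP, cross_left]

lemma irreducible_of_totalDegree_one {P : MvPolynomial (Fin 2) ℂ} (h : P.totalDegree = 1) :
    Irreducible P := by
  refine MvPolynomial.irreducible_of_totalDegree_eq_one h fun x hx => ?_
  rw [isUnit_iff_ne_zero]
  rintro rfl
  have : P = 0 := by
    ext i
    simpa using hx i
  rw [this] at h
  simp at h

lemma exists_param {a b z : Cn 2} (hab : a ≠ b) (h : cross a b z = 0) :
    ∃ t : ℂ, z = a + t • (b - a) := by
  simp only [cross] at h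
  by_cases h0 : b 0 - a 0 = 0
  · have h1 : b 1 - a 1 ≠ 0 := by
      intro h1
      apply hab
      ext i
      fin_cases i
      · exact (sub_eq_zero.1 h0).symm
      · exact (sub_eq_zero.1 h1).symm
    refine ⟨(z 1 - a 1) / (b 1 - a 1), ?_⟩
    ext i
    fin_cases i
    · rw [h0, zero_mul, zero_sub, neg_eq_zero] at h
      have := (mul_eq_zero.1 h).resolve_left h1
      simp [h0]; linear_combination this
    · simp; field_simp; ring
  · refine ⟨(z 0 - a 0) / (b 0 - a 0), ?_⟩
    ext i
    fin_cases i
    · simp; field_simp; ring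
    · simp; field_simp; linear_combination h

lemma cross_param (a b : Cn 2) (t : ℂ) : cross a b (a + t • (b - a)) = 0 := by
  simp [cross]; ring

lemma param_injective {a b : Cn 2} (hab : a ≠ b) :
    Function.Injective fun t : ℂ => a + t • (b - a) := by
  intro s t h
  exact smul_left_injective ℂ (sub_ne_zero.2 hab.symm) (add_left_cancel h)

/-- The line is irreducible and shares infinitely many zeros with P. -/
lemma lineP_dvd {a b : Cn 2} (hab : a ≠ b) {P : MvPolynomial (Fin 2) ℂ}
    (h : ∀ t : ℂ, pev P (a + t • (b - a)) = 0) : lineP a b ∣ P := by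
  by_contra hnd
  have hfin := finite_common_zeros (irreducible_of_totalDegree_one (totalDegree_lineP hab)) hnd
  have : (Set.range fun t : ℂ => a + t • (b - a)).Infinite :=
    Set.infinite_range_of_injective (param_injective hab)
  refine this (hfin.subset ?_)
  rintro _ ⟨t, rfl⟩
  exact ⟨by rw [pev_lineP, cross_param], h t⟩

/-- On the line P becomes a one-variable polynomial with more roots than its degree. -/
lemma pev_line_eq_zero_of_card {a b : Cn 2} (hab : a ≠ b) {P : MvPolynomial (Fin 2) ℂ} {d : ℕ}
    (hd : P.totalDegree ≤ d) {T : Finset (Cn 2)} (hT : d < T.card)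
    (h : ∀ z ∈ T, cross a b z = 0 ∧ pev P z = 0) (t : ℂ) : pev P (a + t • (b - a)) = 0 := by
  choose τ hτ using fun z : T => exists_param hab (h z z.2).1
  have hinj : Function.Injective τ := by
    intro z w hzw
    apply Subtype.ext
    rw [hτ z, hτ w, hzw]
  have h0 : restrictLine P a (b - a) = 0 := by
    refine Polynomial.eq_zero_of_natDegree_lt_card_of_eval_eq_zero _ hinj (fun z => ?_) ?_
    · rw [eval_restrictLine, ← hτ]
      exact (h z z.2).2
    · rw [Fintype.card_coe]
      exact (natDegree_restrictLine_le hd _ _).trans_lt hT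
  rw [← eval_restrictLine, h0, Polynomial.eval_zero]

/-- A curve of degree at most `d + 1` with at least `d + 2` points on a line contains the line. -/
lemma exists_eq_lineP_mul {a b : Cn 2} (hab : a ≠ b) {P : MvPolynomial (Fin 2) ℂ} {d : ℕ}
    (hd : P.totalDegree ≤ d + 1) {T : Finset (Cn 2)} (hT : d + 1 < T.card)
    (h : ∀ z ∈ T, cross a b z = 0 ∧ pev P z = 0) :
    ∃ Q, P = lineP a b * Q ∧ Q.totalDegree ≤ d := by
  obtain ⟨Q, hQ⟩ := lineP_dvd hab (pev_line_eq_zero_of_card hab hd hT h)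
  refine ⟨Q, hQ, ?_⟩
  by_cases hQ0 : Q = 0
  · simp [hQ0]
  · rw [hQ, MvPolynomial.totalDegree_mul_of_isDomain (lineP_ne_zero hab) hQ0,
      totalDegree_lineP hab] at hd
    omega

lemma exists_eq_C_mul_lineP {a b : Cn 2} (hab : a ≠ b) {P : MvPolynomial (Fin 2) ℂ}
    (hd : P.totalDegree ≤ 1) (ha : pev P a = 0) (hb : pev P b = 0) :
    ∃ c, P = MvPolynomial.C c * lineP a b := by
  classical
  obtain ⟨Q, hQ, hQd⟩ := exists_eq_lineP_mul hab (d := 0) hd (T := {a, b})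
    (by rw [Finset.card_pair hab]; norm_num) (by simp [ha, hb])
  rw [MvPolynomial.totalDegree_eq_zero_iff_eq_C.1 (Nat.le_zero.1 hQd)] at hQ
  exact ⟨_, by rw [hQ, mul_comm]⟩

lemma ne_of_cross_ne_zero {a b c : Cn 2} (h : cross a b c ≠ 0) : a ≠ b ∧ a ≠ c ∧ b ≠ c := by
  refine ⟨?_, ?_, ?_⟩ <;> rintro rfl <;> apply h <;> simp only [cross] <;> ring

lemma eq_zero_of_totalDegree_le_one {a b c : Cn 2} (habc : cross a b c ≠ 0)
    {P : MvPolynomial (Fin 2) ℂ} (hd : P.totalDegree ≤ 1) (ha : pev P a = 0) (hb : pev P b = 0)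
    (hc : pev P c = 0) : P = 0 := by
  obtain ⟨k, hk⟩ := exists_eq_C_mul_lineP (ne_of_cross_ne_zero habc).1 hd ha hb
  rw [hk, pev_mul, pev_C, pev_lineP] at hc
  rw [hk, (mul_eq_zero.1 hc).resolve_right habc, map_zero, zero_mul]

/-! ### Conics through five points -/

open scoped Classical in
/-- There is at most one conic through five points no four of which are collinear. -/
theorem conic_unique {B : Finset (Cn 2)} (hB : B.card = 5)
    (h4 : ∀ a ∈ B, ∀ b ∈ B, a ≠ b → (B.filter fun z => cross a b z = 0).card ≤ 3)
    {P Q : MvPolynomial (Fin 2) ℂ} (hP : P.totalDegree ≤ 2) (hQ : Q.totalDegree ≤ 2) (hQ0 : Q ≠ 0)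
    (hPB : ∀ z ∈ B, pev P z = 0) (hQB : ∀ z ∈ B, pev Q z = 0) :
    ∃ c, P = MvPolynomial.C c * Q := by
  by_cases hcol : ∃ a ∈ B, ∃ b ∈ B, ∃ c ∈ B, a ≠ b ∧ a ≠ c ∧ b ≠ c ∧ cross a b c = 0
  · obtain ⟨a, ha, b, hb, c, hc, hab, hac, hbc, habc⟩ := hcol
    -- A conic with three points on the line ab splits off that line, and the residual line is fixed
    -- by two of the points d, e of B off it.
    set T := B.filter fun z => cross a b z = 0 with hT
    have hTcard : 2 < T.card := by
      have hsub : ({a, b, c} : Finset (Cn 2)) ⊆ T := by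
        intro z hz
        simp only [Finset.mem_insert, Finset.mem_singleton] at hz
        rcases hz with rfl | rfl | rfl <;> simp [*]
      have := Finset.card_le_card hsub
      rw [Finset.card_eq_three.2 ⟨a, b, c, hab, hac, hbc, rfl⟩] at this
      omega
    have hcompl : 1 < (B \ T).card := by
      rw [Finset.card_sdiff_of_subset (show T ⊆ B from Finset.filter_subset _ _)]
      have : T.card ≤ 3 := h4 a ha b hb hab
      omega
    obtain ⟨d, hd, e, he, hde⟩ := Finset.one_lt_card.1 hcompl
    have key : ∀ R : MvPolynomial (Fin 2) ℂ, R.totalDegree ≤ 2 → (∀ z ∈ B, pev R z = 0) →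
        ∃ k, R = MvPolynomial.C k * (lineP a b * lineP d e) := by
      intro R hR hRB
      obtain ⟨R', hR', hR'd⟩ := exists_eq_lineP_mul hab (d := 1) hR hTcard (fun z hz =>
        ⟨(Finset.mem_filter.1 hz).2, hRB z (Finset.mem_filter.1 hz).1⟩)
      have hv : ∀ z ∈ B \ T, pev R' z = 0 := by
        intro z hz
        rw [Finset.mem_sdiff, hT, Finset.mem_filter, not_and] at hz
        have := hRB z hz.1
        rw [hR', pev_mul, pev_lineP] at this
        exact (mul_eq_zero.1 this).resolve_left (hz.2 hz.1)
      obtain ⟨k, hk⟩ := exists_eq_C_mul_lineP hde hR'd (hv d hd) (hv e he)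
      exact ⟨k, by rw [hR', hk]; ring⟩
    obtain ⟨k, hk⟩ := key P hP hPB
    obtain ⟨l, hl⟩ := key Q hQ hQB
    have hl0 : l ≠ 0 := by rintro rfl; apply hQ0; rw [hl]; simp
    refine ⟨k / l, ?_⟩
    rw [hk, hl, ← mul_assoc (MvPolynomial.C (k / l)), ← map_mul, div_mul_cancel₀ _ hl0]
  · push Not at hcol
    obtain ⟨a, ha, b, hb, hab⟩ := Finset.one_lt_card.1 (show 1 < B.card by omega)
    have hcard : 2 < ((B.erase a).erase b).card := by
      rw [Finset.card_erase_of_mem (Finset.mem_erase.2 ⟨hab.symm, hb⟩),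
        Finset.card_erase_of_mem ha]
      omega
    obtain ⟨c, d, e, hc, hd, he, hcd, hce, hde⟩ := Finset.two_lt_card_iff.1 hcard
    simp only [Finset.mem_erase] at hc hd he
    -- A third point of the line ab. A conic through B and r contains that line, and its residual
    -- line passes through the non-collinear c, d, e, so it is zero. Hence a conic through B is
    -- determined by its value at r.
    set r : Cn 2 := a + (2 : ℂ) • (b - a) with hr
    have hra : a ≠ r := fun h => by
      have := param_injective hab (a₁ := 0) (a₂ := 2)
        (show a + (0 : ℂ) • (b - a) = r by rw [zero_smul, add_zero]; exact h)
      norm_num at this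
    have hrb : b ≠ r := fun h => by
      have := param_injective hab (a₁ := 1) (a₂ := 2) (by simpa using h)
      norm_num at this
    have key : ∀ R : MvPolynomial (Fin 2) ℂ, R.totalDegree ≤ 2 → (∀ z ∈ B, pev R z = 0) →
        pev R r = 0 → R = 0 := by
      intro R hR hRB hRr
      obtain ⟨R', hR', hR'd⟩ := exists_eq_lineP_mul hab (d := 1) (T := {a, b, r}) hR
        (by rw [Finset.card_eq_three.2 ⟨a, b, r, hab, hra, hrb, rfl⟩]; norm_num) (by
          intro z hz
          simp only [Finset.mem_insert, Finset.mem_singleton] at hz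
          rcases hz with rfl | rfl | rfl
          · exact ⟨cross_left _ _, hRB _ ha⟩
          · exact ⟨cross_right _ _, hRB _ hb⟩
          · exact ⟨cross_param _ _ _, hRr⟩)
      have hv : ∀ z ∈ B, b ≠ z → a ≠ z → pev R' z = 0 := by
        intro z hz hbz haz
        have := hRB z hz
        rw [hR', pev_mul, pev_lineP] at this
        exact (mul_eq_zero.1 this).resolve_left (hcol a ha b hb z hz hab haz hbz)
      rw [hR', eq_zero_of_totalDegree_le_one
        (hcol c hc.2.2 d hd.2.2 e he.2.2 hcd hce hde) hR'd
        (hv c hc.2.2 hc.1.symm hc.2.1.symm) (hv d hd.2.2 hd.1.symm hd.2.1.symm)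
        (hv e he.2.2 he.1.symm he.2.1.symm), mul_zero]
    have hQr : pev Q r ≠ 0 := fun h => hQ0 (key Q hQ hQB h)
    refine ⟨pev P r / pev Q r, sub_eq_zero.1 (key _ ?_ ?_ ?_)⟩
    · refine (MvPolynomial.totalDegree_sub _ _).trans (max_le hP ?_)
      refine (MvPolynomial.totalDegree_mul _ _).trans ?_
      rwa [MvPolynomial.totalDegree_C, zero_add]
    · intro z hz
      simp [hPB z hz, hQB z hz]
    · rw [pev_sub, pev_mul, pev_C, div_mul_cancel₀ _ hQr, sub_self]

/-! ### The numbers `m_j(S)` -/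

lemma bddAbove_ncard_curve (j : ℕ) (S : Finset (Cn 2)) :
    BddAbove {k : ℕ | ∃ Z : Set (Cn 2), IsAlgCurve j Z ∧ ((S : Set (Cn 2)) ∩ Z).ncard = k} := by
  refine ⟨S.card, ?_⟩
  rintro _ ⟨Z, -, rfl⟩
  rw [← Set.ncard_coe_finset S]
  exact Set.ncard_le_ncard Set.inter_subset_left S.finite_toSet

lemma ncard_le_maxOnCurve {j : ℕ} {S : Finset (Cn 2)} {Z : Set (Cn 2)} (hZ : IsAlgCurve j Z) :
    ((S : Set (Cn 2)) ∩ Z).ncard ≤ maxOnCurve j S :=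
  le_csSup (bddAbove_ncard_curve j S) ⟨Z, hZ, rfl⟩

lemma exists_ncard_eq_maxOnCurve {j : ℕ} {S : Finset (Cn 2)} (h : maxOnCurve j S ≠ 0) :
    ∃ Z : Set (Cn 2), IsAlgCurve j Z ∧ ((S : Set (Cn 2)) ∩ Z).ncard = maxOnCurve j S := by
  refine Nat.sSup_mem ?_ (bddAbove_ncard_curve j S)
  by_contra hne
  apply h
  rw [maxOnCurve, Set.not_nonempty_iff_eq_empty.1 hne, csSup_empty, Nat.bot_eq_zero]

open scoped Classical in
lemma ncard_inter_curve (S : Finset (Cn 2)) (P : MvPolynomial (Fin 2) ℂ) :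
    ((S : Set (Cn 2)) ∩ {z | MvPolynomial.eval (fun i => z i) P = 0}).ncard =
      (S.filter fun z => pev P z = 0).card := by
  rw [← Set.ncard_coe_finset]
  congr 1
  ext z
  rw [Finset.mem_coe, Finset.mem_filter]
  rfl

open scoped Classical in
-- Curves of degree j are defined by exact degree, so P is padded by a power of a coordinate, which
-- only enlarges the zero set.
lemma card_filter_le_maxOnCurve {j : ℕ} {S : Finset (Cn 2)} {P : MvPolynomial (Fin 2) ℂ}
    (hP : P ≠ 0) (hd : P.totalDegree ≤ j) :
    (S.filter fun z => pev P z = 0).card ≤ maxOnCurve j S := by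
  set Q := P * MvPolynomial.X 0 ^ (j - P.totalDegree) with hQ
  have hQd : Q.totalDegree = j := by
    rw [hQ, MvPolynomial.totalDegree_mul_of_isDomain hP (pow_ne_zero _ (MvPolynomial.X_ne_zero 0)),
      MvPolynomial.totalDegree_X_pow]
    omega
  refine le_trans ?_ (ncard_le_maxOnCurve ⟨Q, hQd, rfl⟩)
  rw [ncard_inter_curve]
  refine Finset.card_le_card fun z hz => ?_
  rw [Finset.mem_filter] at hz ⊢
  exact ⟨hz.1, by rw [hQ, pev_mul, hz.2, zero_mul]⟩

/-! ### Pencils of cubics -/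

/-- There is a cubic through any nine points. -/
lemma exists_cubic {Y : Finset (Cn 2)} (hY : Y.card ≤ 9) :
    ∃ P : MvPolynomial (Fin 2) ℂ, P ≠ 0 ∧ P.totalDegree ≤ 3 ∧ ∀ z ∈ Y, pev P z = 0 := by
  -- Exponents of the ten monomials of degree at most 3: one more than the number of conditions.
  let ι := {p : Fin 4 × Fin 4 // (p.1 : ℕ) + p.2 ≤ 3}
  let e : ι → (Fin 2 →₀ ℕ) := fun p => Finsupp.single 0 (p.1.1 : ℕ) + Finsupp.single 1 (p.1.2 : ℕ)
  have he : Function.Injective e := by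
    intro p p' h
    have h0 := DFunLike.congr_fun h 0
    have h1 := DFunLike.congr_fun h 1
    simp [e] at h0 h1
    exact Subtype.ext (Prod.ext (Fin.ext h0) (Fin.ext h1))
  have hcard : Fintype.card ι = 10 := by decide
  let L : (ι → ℂ) →ₗ[ℂ] MvPolynomial (Fin 2) ℂ :=
    Fintype.linearCombination ℂ fun i => MvPolynomial.monomial (e i) (1 : ℂ)
  have hLinj : Function.Injective L := by
    rw [← linearIndependent_iff_injective_fintypeLinearCombination]
    have := (MvPolynomial.basisMonomials (Fin 2) ℂ).linearIndependent.comp e he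
    convert! this using 1
  let M : (ι → ℂ) →ₗ[ℂ] (Y → ℂ) :=
    LinearMap.pi fun y => (MvPolynomial.aeval (R := ℂ) fun i => (y : Cn 2) i).toLinearMap ∘ₗ L
  have hker : M.ker ≠ ⊥ := by
    apply LinearMap.ker_ne_bot_of_finrank_lt
    rw [Module.finrank_fintype_fun_eq_card, Module.finrank_fintype_fun_eq_card, hcard,
      Fintype.card_coe]
    omega
  obtain ⟨c, hc, hc0⟩ := (Submodule.ne_bot_iff _).1 hker
  refine ⟨L c, fun h => hc0 (hLinj (by rw [h, map_zero])), ?_, fun z hz => ?_⟩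
  · refine MvPolynomial.totalDegree_finsetSum_le fun i _ => ?_
    refine (MvPolynomial.totalDegree_smul_le _ _).trans
      ((MvPolynomial.totalDegree_monomial_le _ _).trans ?_)
    rw [Finsupp.sum_fintype _ _ (by simp), Fin.sum_univ_two]
    simpa [e] using i.2
  · have := congrFun (LinearMap.mem_ker.1 hc) ⟨z, hz⟩
    simpa [M, pev, MvPolynomial.aeval_eq_eval] using this

lemma eventually_norm_pev_le {P : MvPolynomial (Fin 2) ℂ} {p : Cn 2} (h : pev P p = 0) :
    ∃ C > 0, ∀ᶠ z in 𝓝 p, ‖pev P z‖ ≤ C * ‖z - p‖ := by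
  obtain ⟨C, hC, hb⟩ := ((differentiable_pev P p).isBigO_sub).exists_pos
  refine ⟨C, hC, ?_⟩
  simpa [h] using hb.bound

lemma one_le_totalDegree_of_irreducible {h : MvPolynomial (Fin 2) ℂ} (hh : Irreducible h) :
    1 ≤ h.totalDegree := by
  by_contra! h0
  have hC := MvPolynomial.totalDegree_eq_zero_iff_eq_C.1 (Nat.lt_one_iff.1 h0)
  apply hh.not_isUnit
  rw [hC]
  refine IsUnit.map _ (isUnit_iff_ne_zero.2 fun h1 => hh.ne_zero ?_)
  rw [hC, h1, map_zero]

open scoped Classical in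
/-- Cubics through eight points no four of which are collinear and no seven of which are on a
conic. -/
lemma exists_cubic_pencil {X : Finset (Cn 2)} (hX : X.card = 8)
    (h3 : ∀ P : MvPolynomial (Fin 2) ℂ, P ≠ 0 → P.totalDegree ≤ 1 →
      (X.filter fun z => pev P z = 0).card ≤ 3)
    (h6 : ∀ P : MvPolynomial (Fin 2) ℂ, P ≠ 0 → P.totalDegree ≤ 2 →
      (X.filter fun z => pev P z = 0).card ≤ 6) :
    ∃ f g : MvPolynomial (Fin 2) ℂ, f.totalDegree = 3 ∧ g.totalDegree ≤ 3 ∧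
      (∀ z ∈ X, pev f z = 0) ∧ (∀ z ∈ X, pev g z = 0) ∧
      {z | pev f z = 0 ∧ pev g z = 0}.Finite := by
  obtain ⟨f, hf0, hfd, hfX⟩ := exists_cubic (Y := X) (by omega)
  obtain ⟨r, hr⟩ := exists_pev_ne_zero hf0
  -- The ninth condition, at a point r off f, prevents g from being a multiple of f.
  obtain ⟨g, hg0, hgd, hgX⟩ := exists_cubic (Y := insert r X)
    ((Finset.card_insert_le _ _).trans (by omega))
  have hgr := hgX r (Finset.mem_insert_self _ _)
  have hgX' : ∀ z ∈ X, pev g z = 0 := fun z hz => hgX z (Finset.mem_insert_of_mem hz)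
  refine ⟨f, g, le_antisymm hfd ?_, hgd, hfX, hgX', ?_⟩
  -- A smaller degree would put all eight points on a conic.
  · by_contra! hlt
    have := h6 f hf0 (by omega)
    rw [Finset.filter_true_of_mem hfX] at this
    omega
  by_contra hinf
  obtain ⟨h, hh, ⟨f', hf'⟩, ⟨g', hg'⟩⟩ := exists_common_factor hf0 hinf
  have hdeg := one_le_totalDegree_of_irreducible hh
  have hf'0 : f' ≠ 0 := by rintro rfl; exact hf0 (by rw [hf', mul_zero])
  have hg'0 : g' ≠ 0 := by rintro rfl; exact hg0 (by rw [hg', mul_zero])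
  have hfsum := MvPolynomial.totalDegree_mul_of_isDomain hh.ne_zero hf'0
  have hgsum := MvPolynomial.totalDegree_mul_of_isDomain hh.ne_zero hg'0
  rw [← hf'] at hfsum
  rw [← hg'] at hgsum
  have hoff : ∀ (P P' : MvPolynomial (Fin 2) ℂ), P = h * P' → (∀ z ∈ X, pev P z = 0) →
      ∀ z ∈ X.filter (fun z => ¬ pev h z = 0), pev P' z = 0 := by
    intro P P' hPP' hP z hz
    rw [Finset.mem_filter] at hz
    have := hP z hz.1
    rw [hPP', pev_mul] at this
    exact (mul_eq_zero.1 this).resolve_left hz.2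
  have hoff_f := hoff f f' hf' hfX
  have hoff_g := hoff g g' hg' hgX'
  have hcount := Finset.card_filter_add_card_filter_not (s := X) (fun z => pev h z = 0)
  suffices hc : ∃ c, g' = MvPolynomial.C c * f' by
    obtain ⟨c, hc⟩ := hc
    have hgf : g = MvPolynomial.C c * f := by rw [hg', hc, hf']; ring
    rw [hgf, pev_mul, pev_C] at hgr
    apply hg0
    rw [hgf, (mul_eq_zero.1 hgr).resolve_right hr, map_zero, zero_mul]
  have hcases : h.totalDegree = 1 ∨ h.totalDegree = 2 ∨ 3 ≤ h.totalDegree := by omega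
  -- The cofactors of h vanish at the points off h: conics through at least five such points, lines
  -- through at least two, or constants. Each time they are proportional.
  rcases hcases with hd | hd | hd
  · have := h3 h hh.ne_zero hd.le
    obtain ⟨B, hBsub, hB⟩ := Finset.exists_subset_card_eq
      (s := X.filter fun z => ¬ pev h z = 0) (n := 5) (by omega)
    refine conic_unique hB (fun a _ b _ hab => ?_) (by omega) (by omega) hf'0
      (fun z hz => hoff_g z (hBsub hz)) (fun z hz => hoff_f z (hBsub hz))
    refine le_trans (Finset.card_le_card ?_)
      (h3 (lineP a b) (lineP_ne_zero hab) (totalDegree_lineP_le a b))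
    intro z hz
    rw [Finset.mem_filter] at hz ⊢
    exact ⟨(Finset.mem_filter.1 (hBsub hz.1)).1, by rw [pev_lineP]; exact hz.2⟩
  · have := h6 h hh.ne_zero hd.le
    obtain ⟨d, hdm, e, hem, hde⟩ := Finset.one_lt_card.1
      (show 1 < (X.filter fun z => ¬ pev h z = 0).card by omega)
    obtain ⟨k, hk⟩ := exists_eq_C_mul_lineP hde (P := f') (by omega) (hoff_f d hdm) (hoff_f e hem)
    obtain ⟨l, hl⟩ := exists_eq_C_mul_lineP hde (P := g') (by omega) (hoff_g d hdm) (hoff_g e hem)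
    have hk0 : k ≠ 0 := by rintro rfl; apply hf'0; rw [hk]; simp
    refine ⟨l / k, ?_⟩
    rw [hk, hl, ← mul_assoc, ← map_mul, div_mul_cancel₀ _ hk0]
  · have hf'C := MvPolynomial.totalDegree_eq_zero_iff_eq_C.1
      (show f'.totalDegree = 0 by omega)
    have hg'C := MvPolynomial.totalDegree_eq_zero_iff_eq_C.1
      (show g'.totalDegree = 0 by omega)
    have hk0 : f'.coeff 0 ≠ 0 := by
      intro h0; apply hf'0; rw [hf'C, h0, map_zero]
    refine ⟨g'.coeff 0 / f'.coeff 0, ?_⟩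
    rw [hg'C, hf'C, ← map_mul]
    simp [hk0]

open scoped Classical in
theorem exists_psh_of_eight_points {X : Finset (Cn 2)} (hX : X.card = 8)
    (h3 : ∀ P : MvPolynomial (Fin 2) ℂ, P ≠ 0 → P.totalDegree ≤ 1 →
      (X.filter fun z => pev P z = 0).card ≤ 3)
    (h6 : ∀ P : MvPolynomial (Fin 2) ℂ, P ≠ 0 → P.totalDegree ≤ 2 →
      (X.filter fun z => pev P z = 0).card ≤ 6) :
    ∃ u : Cn 2 → EReal, IsPSH u Set.univ ∧ growth u = 3 ∧
      (∃ F : Set (Cn 2), F.Finite ∧ LocallyBddOn u Fᶜ) ∧ ∀ p ∈ X, LogUpperBoundAt u 1 p := by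
  obtain ⟨f, g, hfd, hgd, hfX, hgX, hfin⟩ := exists_cubic_pencil hX h3 h6
  have hf0 : f ≠ 0 := by rintro rfl; simp at hfd
  obtain ⟨r, hr⟩ := exists_pev_ne_zero hf0
  refine ⟨logNorm (polyMap f g), isPSH_logNorm (differentiable_polyMap f g)
    ⟨r, fun h => hr (polyMap_eq_zero.1 h).1⟩, ?_, ⟨_, hfin, ?_⟩, fun p hp => ?_⟩
  · rw [growth_logNorm_polyMap (d := 3) (by norm_num) hfd.le hgd (Or.inl hfd)]
    norm_num
  · exact locallyBddOn_logNorm (differentiable_polyMap f g).continuous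
      fun z hz h => hz (polyMap_eq_zero.1 h)
  · obtain ⟨C1, hC1, h1⟩ := eventually_norm_pev_le (hfX p hp)
    obtain ⟨C2, hC2, h2⟩ := eventually_norm_pev_le (hgX p hp)
    have := logUpperBoundAt_logNorm (Φ := polyMap f g) (p := p) (k := 1) (C := C1 + C2)
      (by positivity) (by
        filter_upwards [h1, h2] with z hz1 hz2
        rw [pow_one, add_mul]
        exact (norm_polyMap_le f g z).trans (add_le_add hz1 hz2))
    simpa using this

/-! ### Quartics with three double points and four simple points

The conics through three non collinear points `a`, `b`, `c` are the zero sets of linear forms in the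
products of pairs of barycentric coordinates with respect to `a`, `b`, `c`. -/

/-- The determinant whose vanishing says that `z` is on the conic through `a, b, c, s, t`. -/
def conicDet (a b c s t z : Cn 2) : ℂ :=
  cross b c s * (cross c a t * cross a b s - cross a b t * cross c a s) * cross b c t *
      (cross c a z * cross a b z) +
    cross c a s * (cross a b t * cross b c s - cross b c t * cross a b s) * cross c a t *
      (cross b c z * cross a b z) +
    cross a b s * (cross b c t * cross c a s - cross c a t * cross b c s) * cross a b t *
      (cross b c z * cross c a z)

/-- The equation of the conic through `a, b, c, s, t`. -/
noncomputable def conicP (a b c s t : Cn 2) : MvPolynomial (Fin 2) ℂ :=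
  MvPolynomial.C (cross b c s * (cross c a t * cross a b s - cross a b t * cross c a s) *
      cross b c t) * (lineP c a * lineP a b) +
    MvPolynomial.C (cross c a s * (cross a b t * cross b c s - cross b c t * cross a b s) *
      cross c a t) * (lineP b c * lineP a b) +
    MvPolynomial.C (cross a b s * (cross b c t * cross c a s - cross c a t * cross b c s) *
      cross a b t) * (lineP b c * lineP c a)

@[simp] lemma pev_conicP (a b c s t z : Cn 2) :
    pev (conicP a b c s t) z = conicDet a b c s t z := by
  simp [conicP, conicDet]

lemma totalDegree_conicP_le (a b c s t : Cn 2) : (conicP a b c s t).totalDegree ≤ 2 := by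
  have h : ∀ (k : ℂ) (x y z w : Cn 2),
      (MvPolynomial.C k * (lineP x y * lineP z w)).totalDegree ≤ 2 := by
    intro k x y z w
    refine (MvPolynomial.totalDegree_mul _ _).trans ?_
    rw [MvPolynomial.totalDegree_C, zero_add]
    exact (MvPolynomial.totalDegree_mul _ _).trans
      (add_le_add (totalDegree_lineP_le _ _) (totalDegree_lineP_le _ _))
  exact (MvPolynomial.totalDegree_add _ _).trans (max_le
    ((MvPolynomial.totalDegree_add _ _).trans (max_le (h _ _ _ _ _) (h _ _ _ _ _))) (h _ _ _ _ _))

/-- In barycentric coordinates x, y, w, `conicDet` is the determinant of the vectors (1/x, 1/y, 1/w)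
of s, t, z, cleared of denominators: collinearity after the Cremona transformation. This explains
its invariance in the vertices and its alternation in s, t, z. -/
lemma conicDet_rotate (a b c s t z : Cn 2) : conicDet b c a s t z = conicDet a b c s t z := by
  simp only [conicDet]; ring

lemma conicDet_swap (a b c s t z : Cn 2) : conicDet a b c t s z = -conicDet a b c s t z := by
  simp only [conicDet]; ring

lemma conicDet_reverse (a b c s t z : Cn 2) : conicDet a b c z t s = -conicDet a b c s t z := by
  simp only [conicDet]; ring

lemma conicDet_vertex (a b c s t : Cn 2) : conicDet a b c s t a = 0 := by
  simp [conicDet]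

lemma conicDet_left (a b c s t : Cn 2) : conicDet a b c s t s = 0 := by
  simp only [conicDet]; ring

lemma conicDet_right (a b c s t : Cn 2) : conicDet a b c s t t = 0 := by
  simp only [conicDet]; ring

lemma conicDet_rotate_points (a b c s t z : Cn 2) :
    conicDet a b c t z s = conicDet a b c s t z := by
  simp only [conicDet]; ring

lemma cross_sum (a b c z : Cn 2) : cross b c z + cross c a z + cross a b z = cross a b c := by
  simp only [cross]; ring

/-- The pencil of conics through a, b, c, s contains the degenerate member formed by the side bc and
the line as. It is obtained by eliminating the one product of coordinates that does not vanish on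
bc. -/
lemma conicDet_relation (a b c s t t' z : Cn 2) :
    conicDet a b c s t t' * (cross b c z * (cross c a s * cross a b z - cross a b s * cross c a z) *
      cross b c s) =
    cross b c s * (cross c a t * cross a b s - cross a b t * cross c a s) * cross b c t *
      conicDet a b c s t' z -
    cross b c s * (cross c a t' * cross a b s - cross a b t' * cross c a s) * cross b c t' *
      conicDet a b c s t z := by
  simp only [conicDet]; ring

lemma cross_smul_sub (a b c z w : Cn 2) : cross a b c • (z - w) =
    (cross c a z - cross c a w) • (b - a) + (cross a b z - cross a b w) • (c - a) := by
  ext i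
  fin_cases i <;> simp [cross] <;> ring

lemma eq_of_cross_eq {a b c z w : Cn 2} (h : cross a b c ≠ 0) (h1 : cross c a z = cross c a w)
    (h2 : cross a b z = cross a b w) : z = w := by
  have := cross_smul_sub a b c z w
  rw [h1, h2, sub_self, sub_self, zero_smul, zero_smul, add_zero, smul_eq_zero] at this
  exact sub_eq_zero.1 (this.resolve_left h)

lemma norm_sub_le_cross {a b c : Cn 2} (h : cross a b c ≠ 0) :
    ∃ C > 0, ∀ z w, ‖z - w‖ ≤
      C * (‖cross c a z - cross c a w‖ + ‖cross a b z - cross a b w‖) := by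
  have hpos : 0 < ‖cross a b c‖ := norm_pos_iff.2 h
  have hab : 0 < ‖b - a‖ := norm_pos_iff.2 (sub_ne_zero.2 (ne_of_cross_ne_zero h).1.symm)
  refine ⟨(‖b - a‖ + ‖c - a‖) / ‖cross a b c‖, by positivity, fun z w => ?_⟩
  have h1 := congrArg norm (cross_smul_sub a b c z w)
  rw [norm_smul] at h1
  have h2 := norm_add_le ((cross c a z - cross c a w) • (b - a))
    ((cross a b z - cross a b w) • (c - a))
  rw [← h1, norm_smul, norm_smul] at h2
  rw [div_mul_eq_mul_div, le_div_iff₀ hpos]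
  nlinarith [norm_nonneg (cross c a z - cross c a w), norm_nonneg (cross a b z - cross a b w),
    norm_nonneg (b - a), norm_nonneg (c - a)]

lemma continuous_cross (a b : Cn 2) : Continuous (cross a b) := by
  have : cross a b = pev (lineP a b) := funext fun z => (pev_lineP a b z).symm
  rw [this]
  exact (differentiable_pev _).continuous

/-- `s` is on none of the three sides of the triangle `a, b, c`. -/
def OffSides (a b c s : Cn 2) : Prop := cross b c s ≠ 0 ∧ cross c a s ≠ 0 ∧ cross a b s ≠ 0

lemma OffSides.rotate {a b c s : Cn 2} (h : OffSides a b c s) : OffSides b c a s :=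
  ⟨h.2.1, h.2.2, h.1⟩

/-- Two conics through `a, b, c, s` have only these points in common. -/
lemma eq_of_conicDet_eq_zero {a b c s t t' z : Cn 2} (h : cross a b c ≠ 0)
    (hs : OffSides a b c s) (hδ : conicDet a b c s t t' ≠ 0) (h1 : conicDet a b c s t z = 0)
    (h2 : conicDet a b c s t' z = 0) : z = a ∨ z = b ∨ z = c ∨ z = s := by
  -- A common zero lies on each of the three degenerate conics of the pencil, one for each vertex.
  have key : ∀ {a b c : Cn 2}, OffSides a b c s → conicDet a b c s t t' ≠ 0 →
      conicDet a b c s t z = 0 → conicDet a b c s t' z = 0 →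
      cross b c z = 0 ∨ cross c a s * cross a b z = cross a b s * cross c a z := by
    intro a b c hs hδ h1 h2
    have hr := conicDet_relation a b c s t t' z
    rw [h1, h2, mul_zero, mul_zero, sub_zero] at hr
    rcases mul_eq_zero.1 ((mul_eq_zero.1 ((mul_eq_zero.1 hr).resolve_left hδ)).resolve_right hs.1)
      with h | h
    · exact Or.inl h
    · exact Or.inr (sub_eq_zero.1 h)
  have vert : ∀ {a b c : Cn 2}, cross a b c ≠ 0 → cross c a z = 0 → cross a b z = 0 → z = a := by
    intro a b c h h1 h2
    exact eq_of_cross_eq h (by rw [h1, cross_right]) (by rw [h2, cross_left])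
  have hb : cross b c a ≠ 0 := by rwa [cross_rotate]
  have hc : cross c a b ≠ 0 := by rwa [cross_rotate]
  have k0 := key hs hδ h1 h2
  have k1 := key hs.rotate (by rwa [conicDet_rotate]) (by rwa [conicDet_rotate])
    (by rwa [conicDet_rotate])
  have k2 := key hs.rotate.rotate (by rwa [conicDet_rotate, conicDet_rotate])
    (by rwa [conicDet_rotate, conicDet_rotate]) (by rwa [conicDet_rotate, conicDet_rotate])
  obtain ⟨hs0, hs1, hs2⟩ := hs
  by_cases e0 : cross b c z = 0
  · rw [e0, mul_zero] at k1
    rcases k1 with k1 | k1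
    · exact Or.inr (Or.inr (Or.inl (vert hc e0 k1)))
    · exact Or.inr (Or.inl (vert hb ((mul_eq_zero.1 k1.symm).resolve_left hs0) e0))
  by_cases e1 : cross c a z = 0
  · rw [e1, mul_zero] at k2
    rcases k2 with k2 | k2
    · exact Or.inl (vert h e1 k2)
    · exact absurd ((mul_eq_zero.1 k2.symm).resolve_left hs1) e0
  by_cases e2 : cross a b z = 0
  · rw [e2, mul_zero] at k0
    exact absurd ((mul_eq_zero.1 (k0.resolve_left e0).symm).resolve_left hs2) e1
  replace k0 := k0.resolve_left e0
  replace k1 := k1.resolve_left e1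
  replace k2 := k2.resolve_left e2
  -- Off the sides, z and s have proportional barycentric coordinates with the same sum, hence
  -- coincide.
  have hz := cross_sum a b c z
  have hss := cross_sum a b c s
  refine Or.inr (Or.inr (Or.inr (eq_of_cross_eq h ?_ ?_)))
  · refine mul_left_cancel₀ h ?_
    linear_combination cross c a s * hz - cross c a z * hss - k0 + k2
  · refine mul_left_cancel₀ h ?_
    linear_combination cross a b s * hz - cross a b z * hss - k1 + k0

/-- Quantitative form of `conicDet_relation`: the degenerate conic is controlled by the two
generators of the pencil. -/
lemma exists_cross_bound {a b c s t t' : Cn 2} (hs : OffSides a b c s)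
    (hδ : conicDet a b c s t t' ≠ 0) : ∃ C > 0, ∀ z,
      ‖cross b c z‖ * ‖cross c a s * cross a b z - cross a b s * cross c a z‖ ≤
        C * (‖conicDet a b c s t z‖ + ‖conicDet a b c s t' z‖) := by
  set k1 := cross b c s * (cross c a t * cross a b s - cross a b t * cross c a s) * cross b c t
  set k2 := cross b c s * (cross c a t' * cross a b s - cross a b t' * cross c a s) * cross b c t'
  have hpos : 0 < ‖conicDet a b c s t t' * cross b c s‖ := norm_pos_iff.2 (mul_ne_zero hδ hs.1)
  refine ⟨(‖k1‖ + ‖k2‖ + 1) / ‖conicDet a b c s t t' * cross b c s‖, by positivity, fun z => ?_⟩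
  have hr : cross b c z * (cross c a s * cross a b z - cross a b s * cross c a z) *
      (conicDet a b c s t t' * cross b c s) =
      k1 * conicDet a b c s t' z - k2 * conicDet a b c s t z := by
    rw [← conicDet_relation]; ring
  have h1 := norm_sub_le (k1 * conicDet a b c s t' z) (k2 * conicDet a b c s t z)
  rw [← hr, norm_mul _ (conicDet a b c s t t' * cross b c s), norm_mul (cross b c z),
    norm_mul k1, norm_mul k2] at h1
  rw [div_mul_eq_mul_div, le_div_iff₀ hpos]
  nlinarith [norm_nonneg (conicDet a b c s t z), norm_nonneg (conicDet a b c s t' z),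
    norm_nonneg k1, norm_nonneg k2]

/-- Two conics through `a, b, c, s` are transversal at `a`. -/
lemma norm_sub_le_conicDet_vertex {a b c s t t' : Cn 2} (h : cross a b c ≠ 0)
    (hs : OffSides a b c s) (hδ : conicDet a b c s t t' ≠ 0) :
    ∃ C > 0, ∀ᶠ z in 𝓝 a,
      ‖z - a‖ ≤ C * (‖conicDet a b c s t z‖ + ‖conicDet a b c s t' z‖) := by
  obtain ⟨C0, hC0, h0⟩ := norm_sub_le_cross h
  obtain ⟨C1, hC1, h1⟩ := exists_cross_bound hs.rotate (t := t) (t' := t')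
    (by rwa [conicDet_rotate])
  obtain ⟨C2, hC2, h2⟩ := exists_cross_bound hs.rotate.rotate (t := t) (t' := t')
    (by rwa [conicDet_rotate, conicDet_rotate])
  simp only [conicDet_rotate] at h1 h2
  have hc1 : Continuous fun z => ‖cross a b s * cross b c z - cross b c s * cross a b z‖ := by
    have := continuous_cross a b; have := continuous_cross b c; fun_prop
  have hc2 : Continuous fun z => ‖cross b c s * cross c a z - cross c a s * cross b c z‖ := by
    have := continuous_cross c a; have := continuous_cross b c; fun_prop
  have hbca : cross b c a ≠ 0 := by rwa [cross_rotate]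
  have v1 : 0 < ‖cross a b s * cross b c a - cross b c s * cross a b a‖ := by
    rw [cross_left, mul_zero, sub_zero]
    exact norm_pos_iff.2 (mul_ne_zero hs.2.2 hbca)
  have v2 : 0 < ‖cross b c s * cross c a a - cross c a s * cross b c a‖ := by
    rw [cross_right, mul_zero, zero_sub, norm_neg]
    exact norm_pos_iff.2 (mul_ne_zero hs.2.1 hbca)
  set m1 := ‖cross a b s * cross b c a - cross b c s * cross a b a‖ with hm1
  set m2 := ‖cross b c s * cross c a a - cross c a s * cross b c a‖ with hm2
  refine ⟨C0 * (C1 / (m1 / 2) + C2 / (m2 / 2)), by positivity, ?_⟩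
  filter_upwards [(hc1.tendsto a).eventually_const_lt (half_lt_self v1),
    (hc2.tendsto a).eventually_const_lt (half_lt_self v2)] with z hz1 hz2
  have b1 : ‖cross c a z‖ ≤ C1 / (m1 / 2) *
      (‖conicDet a b c s t z‖ + ‖conicDet a b c s t' z‖) := by
    rw [div_mul_eq_mul_div, le_div_iff₀ (by positivity)]
    exact (mul_le_mul_of_nonneg_left hz1.le (norm_nonneg _)).trans (h1 z)
  have b2 : ‖cross a b z‖ ≤ C2 / (m2 / 2) *
      (‖conicDet a b c s t z‖ + ‖conicDet a b c s t' z‖) := by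
    rw [div_mul_eq_mul_div, le_div_iff₀ (by positivity)]
    exact (mul_le_mul_of_nonneg_left hz2.le (norm_nonneg _)).trans (h2 z)
  refine (h0 z a).trans ?_
  rw [cross_left, cross_right, sub_zero, sub_zero, mul_assoc, add_mul]
  gcongr

/-- Two conics through `a, b, c, s` are transversal at `s`. -/
lemma norm_sub_le_conicDet_point {a b c s t t' : Cn 2} (h : cross a b c ≠ 0)
    (hs : OffSides a b c s) (hδ : conicDet a b c s t t' ≠ 0) :
    ∃ C > 0, ∀ᶠ z in 𝓝 s,
      ‖z - s‖ ≤ C * (‖conicDet a b c s t z‖ + ‖conicDet a b c s t' z‖) := by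
  -- Near s the side factor is bounded below, so the equation of the line joining a vertex to s is
  -- controlled; the three lines together control the coordinates.
  have key : ∀ {a b c : Cn 2}, OffSides a b c s → conicDet a b c s t t' ≠ 0 →
      ∃ C > 0, ∀ᶠ z in 𝓝 s, ‖cross c a s * cross a b z - cross a b s * cross c a z‖ ≤
        C * (‖conicDet a b c s t z‖ + ‖conicDet a b c s t' z‖) := by
    intro a b c hs hδ
    obtain ⟨C, hC, hb⟩ := exists_cross_bound hs hδ
    have hpos : 0 < ‖cross b c s‖ := norm_pos_iff.2 hs.1
    refine ⟨C / (‖cross b c s‖ / 2), by positivity, ?_⟩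
    filter_upwards [((continuous_cross b c).norm.tendsto s).eventually_const_lt
      (half_lt_self hpos)] with z hz
    rw [div_mul_eq_mul_div, le_div_iff₀ (by positivity), mul_comm]
    exact (mul_le_mul_of_nonneg_right hz.le (norm_nonneg _)).trans (hb z)
  obtain ⟨C, hC, hC'⟩ := norm_sub_le_cross h
  obtain ⟨C0, hC0, h0⟩ := key hs hδ
  obtain ⟨C1, hC1, h1⟩ := key hs.rotate (by rwa [conicDet_rotate])
  obtain ⟨C2, hC2, h2⟩ := key hs.rotate.rotate (by rwa [conicDet_rotate, conicDet_rotate])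
  simp only [conicDet_rotate] at h1 h2
  have hD : 0 < ‖cross a b c‖ := norm_pos_iff.2 h
  refine ⟨C * ((C0 + C2) / ‖cross a b c‖ + (C0 + C1) / ‖cross a b c‖), by positivity, ?_⟩
  filter_upwards [h0, h1, h2] with z hz0 hz1 hz2
  have hz := cross_sum a b c z
  have hss := cross_sum a b c s
  have b1 : ‖cross c a z - cross c a s‖ ≤ (C0 + C2) / ‖cross a b c‖ *
      (‖conicDet a b c s t z‖ + ‖conicDet a b c s t' z‖) := by
    rw [div_mul_eq_mul_div, le_div_iff₀ hD, ← norm_mul, add_mul]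
    have e : (cross c a z - cross c a s) * cross a b c =
        (cross b c s * cross c a z - cross c a s * cross b c z) -
          (cross c a s * cross a b z - cross a b s * cross c a z) := by
      linear_combination cross c a s * hz - cross c a z * hss
    rw [e]
    refine (norm_sub_le _ _).trans ?_
    linarith
  have b2 : ‖cross a b z - cross a b s‖ ≤ (C0 + C1) / ‖cross a b c‖ *
      (‖conicDet a b c s t z‖ + ‖conicDet a b c s t' z‖) := by
    rw [div_mul_eq_mul_div, le_div_iff₀ hD, ← norm_mul, add_mul]
    have e : (cross a b z - cross a b s) * cross a b c =
        (cross c a s * cross a b z - cross a b s * cross c a z) -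
          (cross a b s * cross b c z - cross b c s * cross a b z) := by
      linear_combination cross a b s * hz - cross a b z * hss
    rw [e]
    refine (norm_sub_le _ _).trans ?_
    linarith
  refine (hC' z s).trans ?_
  rw [mul_assoc, add_mul]
  gcongr

/-! ### Logarithmic poles for pairs of products of curves. -/

/-- In each pair xᵢ, yⱼ one entry is at least r/(2C). Either both x's are that large, or one x is
small and then both y's are large. -/
lemma sq_le_of_pairwise {r x₁ x₂ y₁ y₂ C : ℝ} (hr : 0 ≤ r) (hC : 0 < C) (hx₁ : 0 ≤ x₁)
    (hx₂ : 0 ≤ x₂) (hy₁ : 0 ≤ y₁) (hy₂ : 0 ≤ y₂) (h₁₁ : r ≤ C * (x₁ + y₁))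
    (h₁₂ : r ≤ C * (x₁ + y₂)) (h₂₁ : r ≤ C * (x₂ + y₁)) (h₂₂ : r ≤ C * (x₂ + y₂)) :
    r ^ 2 ≤ 4 * C ^ 2 * (x₁ * x₂ + y₁ * y₂) := by
  have hprod : ∀ {x y : ℝ}, r ≤ 2 * C * x → r ≤ 2 * C * y → r ^ 2 ≤ 4 * C ^ 2 * (x * y) := by
    intro x y hx hy
    calc r ^ 2 = r * r := sq r
      _ ≤ (2 * C * x) * (2 * C * y) := mul_le_mul hx hy hr (hr.trans hx)
      _ = _ := by ring
  have hC2 : 0 < 4 * C ^ 2 := by positivity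
  by_cases h1 : r ≤ 2 * C * x₁
  · by_cases h2 : r ≤ 2 * C * x₂
    · nlinarith [hprod h1 h2, mul_nonneg hy₁ hy₂]
    · nlinarith [hprod (x := y₁) (y := y₂) (by linarith) (by linarith), mul_nonneg hx₁ hx₂]
  · nlinarith [hprod (x := y₁) (y := y₂) (by linarith) (by linarith), mul_nonneg hx₁ hx₂]

lemma hasLogPole_one {F₁ F₂ G₁ G₂ : MvPolynomial (Fin 2) ℂ} {p : Cn 2} (hF₁ : pev F₁ p = 0)
    (hG₁ : pev G₁ p = 0) (hF₂ : pev F₂ p ≠ 0) (hG₂ : pev G₂ p ≠ 0)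
    (h : ∃ C > 0, ∀ᶠ z in 𝓝 p, ‖z - p‖ ≤ C * (‖pev F₁ z‖ + ‖pev G₁ z‖)) :
    HasLogPole (logNorm (polyMap (F₁ * F₂) (G₁ * G₂))) 1 p := by
  obtain ⟨C, hC, h⟩ := h
  obtain ⟨C₁, hC₁, h₁⟩ := eventually_norm_pev_le (P := F₁ * F₂) (p := p) (by simp [hF₁])
  obtain ⟨C₂, hC₂, h₂⟩ := eventually_norm_pev_le (P := G₁ * G₂) (p := p) (by simp [hG₁])
  set m := min (‖pev F₂ p‖) (‖pev G₂ p‖) with hm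
  have hmpos : 0 < m := lt_min (norm_pos_iff.2 hF₂) (norm_pos_iff.2 hG₂)
  have e₁ := ((differentiable_pev F₂).continuous.norm.tendsto p).eventually_const_lt
    ((half_lt_self hmpos).trans_le (min_le_left _ _))
  have e₂ := ((differentiable_pev G₂).continuous.norm.tendsto p).eventually_const_lt
    ((half_lt_self hmpos).trans_le (min_le_right _ _))
  have := hasLogPole_logNorm (Φ := polyMap (F₁ * F₂) (G₁ * G₂)) (p := p) (k := 1)
    (c := m / (4 * C)) (C := C₁ + C₂) (by positivity) (by positivity) (by
      filter_upwards [h, e₁, e₂] with z hz hz₁ hz₂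
      have n₁ := norm_left_le_polyMap (F₁ * F₂) (G₁ * G₂) z
      have n₂ := norm_right_le_polyMap (F₁ * F₂) (G₁ * G₂) z
      rw [pev_mul, norm_mul] at n₁ n₂
      have l₁ := mul_le_mul_of_nonneg_left hz₁.le (norm_nonneg (pev F₁ z))
      have l₂ := mul_le_mul_of_nonneg_left hz₂.le (norm_nonneg (pev G₁ z))
      rw [pow_one, div_mul_eq_mul_div, div_le_iff₀ (by positivity)]
      calc m * ‖z - p‖ ≤ m * (C * (‖pev F₁ z‖ + ‖pev G₁ z‖)) := by gcongr
        _ = 2 * C * (‖pev F₁ z‖ * (m / 2) + ‖pev G₁ z‖ * (m / 2)) := by ring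
        _ ≤ 2 * C * (‖polyMap (F₁ * F₂) (G₁ * G₂) z‖ +
            ‖polyMap (F₁ * F₂) (G₁ * G₂) z‖) := by
          gcongr
          · exact l₁.trans n₁
          · exact l₂.trans n₂
        _ = _ := by ring) (by
      filter_upwards [h₁, h₂] with z hz₁ hz₂
      rw [pow_one, add_mul]
      exact (norm_polyMap_le _ _ z).trans (add_le_add hz₁ hz₂))
  simpa using this

/-- If each factor of the first product is transversal to each factor of the second, the two
products have no common tangent at p, so the map is of exact order 2 there. -/
lemma hasLogPole_two {F₁ F₂ G₁ G₂ : MvPolynomial (Fin 2) ℂ} {p : Cn 2} (hF₁ : pev F₁ p = 0)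
    (hG₁ : pev G₁ p = 0) (hF₂ : pev F₂ p = 0) (hG₂ : pev G₂ p = 0)
    (h₁₁ : ∃ C > 0, ∀ᶠ z in 𝓝 p, ‖z - p‖ ≤ C * (‖pev F₁ z‖ + ‖pev G₁ z‖))
    (h₁₂ : ∃ C > 0, ∀ᶠ z in 𝓝 p, ‖z - p‖ ≤ C * (‖pev F₁ z‖ + ‖pev G₂ z‖))
    (h₂₁ : ∃ C > 0, ∀ᶠ z in 𝓝 p, ‖z - p‖ ≤ C * (‖pev F₂ z‖ + ‖pev G₁ z‖))
    (h₂₂ : ∃ C > 0, ∀ᶠ z in 𝓝 p, ‖z - p‖ ≤ C * (‖pev F₂ z‖ + ‖pev G₂ z‖)) :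
    HasLogPole (logNorm (polyMap (F₁ * F₂) (G₁ * G₂))) 2 p := by
  obtain ⟨A₁, hA₁, a₁⟩ := eventually_norm_pev_le hF₁
  obtain ⟨A₂, hA₂, a₂⟩ := eventually_norm_pev_le hF₂
  obtain ⟨B₁, hB₁, b₁⟩ := eventually_norm_pev_le hG₁
  obtain ⟨B₂, hB₂, b₂⟩ := eventually_norm_pev_le hG₂
  obtain ⟨C₁, hC₁, h₁₁⟩ := h₁₁
  obtain ⟨C₂, hC₂, h₁₂⟩ := h₁₂
  obtain ⟨C₃, hC₃, h₂₁⟩ := h₂₁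
  obtain ⟨C₄, hC₄, h₂₂⟩ := h₂₂
  set C := C₁ + C₂ + C₃ + C₄ with hC
  have hCpos : 0 < C := by positivity
  have := hasLogPole_logNorm (Φ := polyMap (F₁ * F₂) (G₁ * G₂)) (p := p) (k := 2)
    (c := 1 / (8 * C ^ 2)) (C := A₁ * A₂ + B₁ * B₂) (by positivity) (by positivity) (by
      filter_upwards [h₁₁, h₁₂, h₂₁, h₂₂] with z z₁ z₂ z₃ z₄
      have n₁ := norm_left_le_polyMap (F₁ * F₂) (G₁ * G₂) z
      have n₂ := norm_right_le_polyMap (F₁ * F₂) (G₁ * G₂) z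
      rw [pev_mul, norm_mul] at n₁ n₂
      have mono : ∀ {D x y : ℝ}, D ≤ C → 0 ≤ x → 0 ≤ y → ‖z - p‖ ≤ D * (x + y) →
          ‖z - p‖ ≤ C * (x + y) := fun hD hx hy hle =>
        hle.trans (mul_le_mul_of_nonneg_right hD (add_nonneg hx hy))
      have hsq := sq_le_of_pairwise (norm_nonneg (z - p)) hCpos (norm_nonneg (pev F₁ z))
        (norm_nonneg (pev F₂ z)) (norm_nonneg (pev G₁ z)) (norm_nonneg (pev G₂ z))
        (mono (by linarith) (norm_nonneg _) (norm_nonneg _) z₁)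
        (mono (by linarith) (norm_nonneg _) (norm_nonneg _) z₂)
        (mono (by linarith) (norm_nonneg _) (norm_nonneg _) z₃)
        (mono (by linarith) (norm_nonneg _) (norm_nonneg _) z₄)
      rw [div_mul_eq_mul_div, one_mul, div_le_iff₀ (by positivity)]
      calc ‖z - p‖ ^ 2 ≤ 4 * C ^ 2 * (‖pev F₁ z‖ * ‖pev F₂ z‖ + ‖pev G₁ z‖ * ‖pev G₂ z‖) := hsq
        _ ≤ 4 * C ^ 2 * (‖polyMap (F₁ * F₂) (G₁ * G₂) z‖ +
            ‖polyMap (F₁ * F₂) (G₁ * G₂) z‖) := by gcongr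
        _ = _ := by ring) (by
      filter_upwards [a₁, a₂, b₁, b₂] with z z₁ z₂ z₃ z₄
      refine (norm_polyMap_le _ _ z).trans ?_
      rw [pev_mul, pev_mul, norm_mul, norm_mul]
      calc ‖pev F₁ z‖ * ‖pev F₂ z‖ + ‖pev G₁ z‖ * ‖pev G₂ z‖
          ≤ (A₁ * ‖z - p‖) * (A₂ * ‖z - p‖) + (B₁ * ‖z - p‖) * (B₂ * ‖z - p‖) := by gcongr
        _ = _ := by ring)
  simpa using this

/-- A pencil of quartics with double points at `a, b, c` and simple points at `s₁, s₂, s₃, s₄`. -/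
noncomputable def quarticMap (a b c s₁ s₂ s₃ s₄ : Cn 2) : Cn 2 → Cn 2 :=
  polyMap (conicP a b c s₁ s₂ * conicP a b c s₃ s₄) (conicP a b c s₁ s₃ * conicP a b c s₂ s₄)

lemma quarticMap_rotate (a b c s₁ s₂ s₃ s₄ : Cn 2) :
    quarticMap b c a s₁ s₂ s₃ s₄ = quarticMap a b c s₁ s₂ s₃ s₄ := by
  funext z
  simp only [quarticMap, polyMap, pev_mul, pev_conicP, conicDet_rotate]

/-- Each conic of the first product shares exactly one sᵢ with each conic of the second, and all
four sᵢ occur; each pair is transversal at a as part of the pencil through that sᵢ. -/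
lemma hasLogPole_quarticMap_vertex {a b c s₁ s₂ s₃ s₄ : Cn 2} (h : cross a b c ≠ 0)
    (o₁ : OffSides a b c s₁) (o₂ : OffSides a b c s₂) (o₃ : OffSides a b c s₃)
    (o₄ : OffSides a b c s₄) (d₁ : conicDet a b c s₂ s₃ s₄ ≠ 0)
    (d₂ : conicDet a b c s₁ s₃ s₄ ≠ 0) (d₃ : conicDet a b c s₁ s₂ s₄ ≠ 0)
    (d₄ : conicDet a b c s₁ s₂ s₃ ≠ 0) :
    HasLogPole (logNorm (quarticMap a b c s₁ s₂ s₃ s₄)) 2 a := by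
  have nswap : ∀ s t z, ‖conicDet a b c t s z‖ = ‖conicDet a b c s t z‖ := fun s t z => by
    rw [conicDet_swap, norm_neg]
  refine hasLogPole_two ?_ ?_ ?_ ?_ ?_ ?_ ?_ ?_ <;> simp only [pev_conicP, conicDet_vertex]
  · exact norm_sub_le_conicDet_vertex h o₁ d₄
  · have := norm_sub_le_conicDet_vertex h o₂ (t := s₁) (t' := s₄)
      (by rwa [conicDet_swap, neg_ne_zero])
    simpa only [nswap s₁ s₂] using this
  · have := norm_sub_le_conicDet_vertex h o₃ (t := s₄) (t' := s₁)
      (by rwa [conicDet_rotate_points])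
    simpa only [nswap s₁ s₃] using this
  · have := norm_sub_le_conicDet_vertex h o₄ (t := s₃) (t' := s₂)
      (by rwa [conicDet_swap, conicDet_rotate_points, neg_ne_zero])
    simpa only [nswap s₃ s₄, nswap s₂ s₄] using this

lemma hasLogPole_quarticMap_point {a b c s₁ s₂ s₃ s₄ : Cn 2} (h : cross a b c ≠ 0)
    (o₁ : OffSides a b c s₁) (d₂ : conicDet a b c s₁ s₃ s₄ ≠ 0)
    (d₃ : conicDet a b c s₁ s₂ s₄ ≠ 0) (d₄ : conicDet a b c s₁ s₂ s₃ ≠ 0) :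
    HasLogPole (logNorm (quarticMap a b c s₁ s₂ s₃ s₄)) 1 s₁ := by
  refine hasLogPole_one ?_ ?_ ?_ ?_ ?_ <;> simp only [pev_conicP]
  · exact conicDet_left ..
  · exact conicDet_left ..
  · rwa [conicDet_rotate_points]
  · rwa [conicDet_rotate_points]
  · exact norm_sub_le_conicDet_point h o₁ d₄

lemma conicP_swap (a b c s t : Cn 2) : conicP a b c t s = -conicP a b c s t := by
  refine sub_eq_zero.1 (eq_zero_of_pev _ fun z => ?_)
  rw [sub_neg_eq_add, pev_add, pev_conicP, pev_conicP, conicDet_swap, neg_add_cancel]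

/-- Together with `logNorm_quarticMap_pair_swap` this symmetry preserves both pairings and is
transitive on the sᵢ, so only the pole at s₁ needs a computation. -/
lemma logNorm_quarticMap_double_swap (a b c s₁ s₂ s₃ s₄ : Cn 2) :
    logNorm (quarticMap a b c s₂ s₁ s₄ s₃) = logNorm (quarticMap a b c s₁ s₂ s₃ s₄) := by
  have : quarticMap a b c s₂ s₁ s₄ s₃ = quarticMap a b c s₁ s₂ s₃ s₄ := by
    rw [quarticMap, quarticMap, conicP_swap a b c s₁ s₂, conicP_swap a b c s₃ s₄, neg_mul_neg,
      mul_comm (conicP a b c s₂ s₄)]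
  rw [this]

lemma logNorm_quarticMap_pair_swap (a b c s₁ s₂ s₃ s₄ : Cn 2) :
    logNorm (quarticMap a b c s₃ s₄ s₁ s₂) = logNorm (quarticMap a b c s₁ s₂ s₃ s₄) := by
  have : quarticMap a b c s₃ s₄ s₁ s₂ = quarticMap a b c s₁ s₂ s₃ s₄ := by
    rw [quarticMap, quarticMap, conicP_swap a b c s₁ s₃, conicP_swap a b c s₂ s₄, neg_mul_neg,
      mul_comm (conicP a b c s₃ s₄)]
  rw [this]

lemma totalDegree_conicP {a b c s t z : Cn 2} (h : cross a b c ≠ 0)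
    (hz : conicDet a b c s t z ≠ 0) : (conicP a b c s t).totalDegree = 2 := by
  refine le_antisymm (totalDegree_conicP_le ..) ?_
  by_contra! hlt
  apply hz
  rw [← pev_conicP, eq_zero_of_totalDegree_le_one h (P := conicP a b c s t) (by omega)
    (by simp [conicDet_vertex]) (by rw [pev_conicP, ← conicDet_rotate, conicDet_vertex])
    (by rw [pev_conicP, ← conicDet_rotate, ← conicDet_rotate, conicDet_vertex]), pev_zero]

/-- A common zero lies on one conic from each product; these two share a, b, c and one sᵢ, and by
`eq_of_conicDet_eq_zero` nothing else. -/
theorem exists_entireGreen_of_general_position {a b c s₁ s₂ s₃ s₄ : Cn 2} (h : cross a b c ≠ 0)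
    (o₁ : OffSides a b c s₁) (o₂ : OffSides a b c s₂) (o₃ : OffSides a b c s₃)
    (o₄ : OffSides a b c s₄) (d₁ : conicDet a b c s₂ s₃ s₄ ≠ 0)
    (d₂ : conicDet a b c s₁ s₃ s₄ ≠ 0) (d₃ : conicDet a b c s₁ s₂ s₄ ≠ 0)
    (d₄ : conicDet a b c s₁ s₂ s₃ ≠ 0) {S : Finset (Cn 2)}
    (hS : ∀ z, z ∈ S ↔ z = a ∨ z = b ∨ z = c ∨ z = s₁ ∨ z = s₂ ∨ z = s₃ ∨ z = s₄) :
    ∃ u : Cn 2 → EReal, IsEntireGreen S u ∧ growth u = 4 ∧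
      HasLogPole u 2 a ∧ HasLogPole u 2 b ∧ HasLogPole u 2 c ∧ HasLogPole u 1 s₁ ∧
      HasLogPole u 1 s₂ ∧ HasLogPole u 1 s₃ ∧ HasLogPole u 1 s₄ := by
  have d₄' : conicDet a b c s₃ s₄ s₁ ≠ 0 := by rwa [conicDet_rotate_points]
  have hb : cross b c a ≠ 0 := by rwa [cross_rotate]
  have hc : cross c a b ≠ 0 := by rwa [cross_rotate]
  have hzero : ∀ z, quarticMap a b c s₁ s₂ s₃ s₄ z = 0 ↔ z ∈ S := by
    intro z
    rw [hS, quarticMap, polyMap_eq_zero, pev_mul, pev_mul, mul_eq_zero, mul_eq_zero]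
    simp only [pev_conicP]
    have nswap : ∀ s t, conicDet a b c t s z = 0 ↔ conicDet a b c s t z = 0 := fun s t => by
      rw [conicDet_swap, neg_eq_zero]
    constructor
    · rintro ⟨hF | hF, hG | hG⟩
      · have := eq_of_conicDet_eq_zero h o₁ d₄ hF hG
        tauto
      · have := eq_of_conicDet_eq_zero h o₂ (t := s₁) (t' := s₄)
          (by rwa [conicDet_swap, neg_ne_zero]) ((nswap _ _).2 hF) hG
        tauto
      · have := eq_of_conicDet_eq_zero h o₃ (t := s₄) (t' := s₁) d₄' hF ((nswap _ _).2 hG)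
        tauto
      · have := eq_of_conicDet_eq_zero h o₄ (t := s₃) (t' := s₂)
          (by rwa [conicDet_swap, conicDet_rotate_points, neg_ne_zero]) ((nswap _ _).2 hF)
          ((nswap _ _).2 hG)
        tauto
    · have va : ∀ s t, conicDet a b c s t a = 0 := conicDet_vertex a b c
      have vb : ∀ s t, conicDet a b c s t b = 0 := fun s t => by
        rw [← conicDet_rotate, conicDet_vertex]
      have vc : ∀ s t, conicDet a b c s t c = 0 := fun s t => by
        rw [← conicDet_rotate, ← conicDet_rotate, conicDet_vertex]
      rintro (rfl | rfl | rfl | rfl | rfl | rfl | rfl) <;>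
        simp [va, vb, vc, conicDet_left, conicDet_right]
  have hdeg : ∀ {s t s' t' z z' : Cn 2}, conicDet a b c s t z ≠ 0 →
      conicDet a b c s' t' z' ≠ 0 → (conicP a b c s t * conicP a b c s' t').totalDegree = 4 := by
    intro s t s' t' z z' hz hz'
    rw [MvPolynomial.totalDegree_mul_of_isDomain, totalDegree_conicP h hz,
      totalDegree_conicP h hz']
    · intro h0; apply hz; rw [← pev_conicP, h0, pev_zero]
    · intro h0; apply hz'; rw [← pev_conicP, h0, pev_zero]
  have hdiff : Differentiable ℂ (quarticMap a b c s₁ s₂ s₃ s₄) := differentiable_polyMap _ _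
  have hne : ∀ z ∈ (S : Set (Cn 2))ᶜ, quarticMap a b c s₁ s₂ s₃ s₄ z ≠ 0 :=
    fun z hz h0 => hz ((hzero z).1 h0)
  have hgrowth : growth (logNorm (quarticMap a b c s₁ s₂ s₃ s₄)) = 4 := by
    rw [quarticMap, growth_logNorm_polyMap (d := 4) (by norm_num) (hdeg d₄ d₄').le
      ((MvPolynomial.totalDegree_mul _ _).trans
        (add_le_add (totalDegree_conicP_le ..) (totalDegree_conicP_le ..)))
      (Or.inl (hdeg d₄ d₄'))]
    norm_num
  refine ⟨logNorm (quarticMap a b c s₁ s₂ s₃ s₄), ⟨isPSH_logNorm hdiff ?_, ?_,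
    locallyBddOn_logNorm hdiff.continuous hne, isMaximalOn_logNorm hdiff hne, ?_⟩, hgrowth,
    hasLogPole_quarticMap_vertex h o₁ o₂ o₃ o₄ d₁ d₂ d₃ d₄, ?_, ?_,
    hasLogPole_quarticMap_point h o₁ d₂ d₃ d₄, ?_, ?_, ?_⟩
  · obtain ⟨z, hz⟩ := Infinite.exists_notMem_finset S
    exact ⟨z, hne z hz⟩
  · rw [hgrowth]
    exact_mod_cast EReal.coe_lt_top 4
  · intro p hp
    simp [logNorm, (hzero p).2 hp]
  · rw [← quarticMap_rotate]
    exact hasLogPole_quarticMap_vertex hb o₁.rotate o₂.rotate o₃.rotate o₄.rotate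
      (by rwa [conicDet_rotate]) (by rwa [conicDet_rotate]) (by rwa [conicDet_rotate])
      (by rwa [conicDet_rotate])
  · rw [← quarticMap_rotate, ← quarticMap_rotate]
    exact hasLogPole_quarticMap_vertex hc o₁.rotate.rotate o₂.rotate.rotate o₃.rotate.rotate
      o₄.rotate.rotate (by rwa [conicDet_rotate, conicDet_rotate])
      (by rwa [conicDet_rotate, conicDet_rotate]) (by rwa [conicDet_rotate, conicDet_rotate])
      (by rwa [conicDet_rotate, conicDet_rotate])
  · rw [← logNorm_quarticMap_double_swap]
    refine hasLogPole_quarticMap_point h o₂ ?_ ?_ ?_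
    · rwa [conicDet_reverse, conicDet_rotate_points, neg_ne_zero]
    · rwa [conicDet_swap, neg_ne_zero]
    · rwa [conicDet_swap, neg_ne_zero]
  · rw [← logNorm_quarticMap_pair_swap]
    refine hasLogPole_quarticMap_point h o₃ ?_ ?_ d₄'
    · rwa [conicDet_rotate_points, conicDet_rotate_points]
    · rwa [conicDet_rotate_points]
  · rw [← logNorm_quarticMap_pair_swap, ← logNorm_quarticMap_double_swap]
    refine hasLogPole_quarticMap_point h o₄ ?_ ?_ ?_ <;> rwa [conicDet_reverse, neg_ne_zero]

/-! ### General position from one conic and one line. -/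

lemma cross_ne_zero_of_pev {ℓ : MvPolynomial (Fin 2) ℂ} (hd : ℓ.totalDegree ≤ 1) {x y z : Cn 2}
    (hxy : x ≠ y) (hx : pev ℓ x = 0) (hy : pev ℓ y = 0) (hz : pev ℓ z ≠ 0) :
    cross x y z ≠ 0 := by
  obtain ⟨k, hk⟩ := exists_eq_C_mul_lineP hxy hd hx hy
  intro h
  apply hz
  rw [hk, pev_mul, pev_lineP, h, mul_zero]

lemma pev_eq_zero_of_cross {ℓ : MvPolynomial (Fin 2) ℂ} (hd : ℓ.totalDegree ≤ 1) {x y z : Cn 2}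
    (hxy : x ≠ y) (hx : pev ℓ x = 0) (hy : pev ℓ y = 0) (hz : cross x y z = 0) :
    pev ℓ z = 0 := by
  by_contra h
  exact cross_ne_zero_of_pev hd hxy hx hy h hz

lemma cross_eq_zero_of_pev {ℓ : MvPolynomial (Fin 2) ℂ} (hd : ℓ.totalDegree ≤ 1) (h0 : ℓ ≠ 0)
    {x y z : Cn 2} (hx : pev ℓ x = 0) (hy : pev ℓ y = 0) (hz : pev ℓ z = 0) :
    cross x y z = 0 := by
  by_contra h
  exact h0 (eq_zero_of_totalDegree_le_one h hd hx hy hz)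

lemma cross_swap_right (x y z : Cn 2) : cross x z y = -cross x y z := by
  simp only [cross]; ring

lemma cross_eq_zero_trans {x w y z : Cn 2} (hxw : x ≠ w) (h1 : cross x y w = 0)
    (h2 : cross x z w = 0) : cross x y z = 0 := by
  obtain ⟨s, rfl⟩ := exists_param hxw (z := y) (by rw [cross_swap_right, h1, neg_zero])
  obtain ⟨t, rfl⟩ := exists_param hxw (z := z) (by rw [cross_swap_right, h2, neg_zero])
  simp only [cross, PiLp.add_apply, PiLp.smul_apply, PiLp.sub_apply, smul_eq_mul]
  ring

lemma eq_of_conicP_eq_zero {a b c s t : Cn 2} (h : cross a b c ≠ 0) (hs : OffSides a b c s)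
    (ht : OffSides a b c t) (h0 : conicP a b c s t = 0) : s = t := by
  have hdet : ∀ z, conicDet a b c s t z = 0 := fun z => by rw [← pev_conicP, h0, pev_zero]
  have key : ∀ {a b c : Cn 2}, cross a b c ≠ 0 → OffSides a b c s → OffSides a b c t →
      (∀ z, conicDet a b c s t z = 0) →
      cross c a t * cross a b s - cross a b t * cross c a s = 0 := by
    intro a b c h hs ht hdet
    -- The midpoint of the side bc annihilates two of the three products and isolates one
    -- coefficient. When all coefficients vanish, s and t have proportional coordinates.
    have hm : conicDet a b c s t ((1 / 2 : ℂ) • (b + c)) =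
        cross b c s * (cross c a t * cross a b s - cross a b t * cross c a s) * cross b c t *
          (cross a b c / 2) ^ 2 := by
      have m0 : cross b c ((1 / 2 : ℂ) • (b + c)) = 0 := by
        simp only [cross, PiLp.smul_apply, PiLp.add_apply, smul_eq_mul]; ring
      have m1 : cross c a ((1 / 2 : ℂ) • (b + c)) = cross a b c / 2 := by
        simp only [cross, PiLp.smul_apply, PiLp.add_apply, smul_eq_mul]; ring
      have m2 : cross a b ((1 / 2 : ℂ) • (b + c)) = cross a b c / 2 := by
        simp only [cross, PiLp.smul_apply, PiLp.add_apply, smul_eq_mul]; ring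
      rw [conicDet, m0, m1, m2]
      ring
    rw [hdet] at hm
    have h2 : (cross a b c / 2) ^ 2 ≠ 0 := pow_ne_zero _ (div_ne_zero h two_ne_zero)
    exact (mul_eq_zero.1 ((mul_eq_zero.1 ((mul_eq_zero.1 hm.symm).resolve_right h2)).resolve_right
      ht.1)).resolve_left hs.1
  have hb : cross b c a ≠ 0 := by rwa [cross_rotate]
  have hc : cross c a b ≠ 0 := by rwa [cross_rotate]
  have k0 := key h hs ht hdet
  have k1 := key hb hs.rotate ht.rotate fun z => by rw [conicDet_rotate, hdet]
  have k2 := key hc hs.rotate.rotate ht.rotate.rotate fun z => by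
    rw [conicDet_rotate, conicDet_rotate, hdet]
  have e1 := cross_sum a b c s
  have e2 := cross_sum a b c t
  refine eq_of_cross_eq h (mul_left_cancel₀ h ?_) (mul_left_cancel₀ h ?_)
  · linear_combination cross c a t * e1 - cross c a s * e2 - k0 + k2
  · linear_combination cross a b t * e1 - cross a b s * e2 - k1 + k0

/-- If it vanished, `conicP` would pass through all six points and so be zero, which happens only
for s = t. -/
lemma conicDet_ne_zero {a b c s t w : Cn 2} (h : cross a b c ≠ 0) (hs : OffSides a b c s)
    (ht : OffSides a b c t) (hst : s ≠ t)
    (hP : ∀ P : MvPolynomial (Fin 2) ℂ, P.totalDegree ≤ 2 → pev P a = 0 → pev P b = 0 →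
      pev P c = 0 → pev P s = 0 → pev P t = 0 → pev P w = 0 → P = 0) :
    conicDet a b c s t w ≠ 0 := by
  intro h0
  refine hst (eq_of_conicP_eq_zero h hs ht (hP _ (totalDegree_conicP_le ..) ?_ ?_ ?_ ?_ ?_ ?_))
  · rw [pev_conicP, conicDet_vertex]
  · rw [pev_conicP, ← conicDet_rotate, conicDet_vertex]
  · rw [pev_conicP, ← conicDet_rotate, ← conicDet_rotate, conicDet_vertex]
  · rw [pev_conicP, conicDet_left]
  · rw [pev_conicP, conicDet_right]
  · rw [pev_conicP, h0]

open scoped Classical in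
/-- Green functions with double poles at `y, i, j` and simple poles at `k, l, w, q`, where
`y, i, j, k, l` are on a conic and `y, w, q` are on a line. -/
theorem exists_entireGreen_of_conic_of_line {y i j k l w q : Cn 2}
    {G ℓ : MvPolynomial (Fin 2) ℂ} (hG : G.totalDegree ≤ 2) (hG0 : G ≠ 0)
    (hGv : ∀ z ∈ ({y, i, j, k, l} : Finset (Cn 2)), pev G z = 0) (hGw : pev G w ≠ 0)
    (hGq : pev G q ≠ 0)
    (h4 : ∀ P : MvPolynomial (Fin 2) ℂ, P ≠ 0 → P.totalDegree ≤ 1 →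
      (({y, i, j, k, l} : Finset (Cn 2)).filter fun z => pev P z = 0).card ≤ 3)
    (hℓ : ℓ.totalDegree ≤ 1) (hℓ0 : ℓ ≠ 0) (hy : pev ℓ y = 0) (hw : pev ℓ w = 0)
    (hq : pev ℓ q = 0) (hi : pev ℓ i ≠ 0) (hj : pev ℓ j ≠ 0) (hk : pev ℓ k ≠ 0)
    (hl : pev ℓ l ≠ 0) (hwq : w ≠ q) (hkl : k ≠ l)
    (cy : cross i j y ≠ 0) (ck : cross i j k ≠ 0) (cl : cross i j l ≠ 0) (cw : cross i j w ≠ 0)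
    (cq : cross i j q ≠ 0) (cik : cross y i k ≠ 0) (cil : cross y i l ≠ 0)
    (cjk : cross y j k ≠ 0) (cjl : cross y j l ≠ 0) :
    ({y, i, j, k, l, w, q} : Finset (Cn 2)).card = 7 ∧ ∃ u : Cn 2 → EReal,
      IsEntireGreen ({y, i, j, k, l, w, q} : Finset (Cn 2)) u ∧ growth u = 4 ∧
        ∃ T ⊆ ({y, i, j, k, l, w, q} : Finset (Cn 2)), T.card = 3 ∧ (∀ p ∈ T, HasLogPole u 2 p) ∧
          ∀ p ∈ ({y, i, j, k, l, w, q} : Finset (Cn 2)) \ T, HasLogPole u 1 p := by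
  have h : cross y i j ≠ 0 := by rwa [← cross_rotate]
  have ne_of : ∀ {P : MvPolynomial (Fin 2) ℂ} {x z : Cn 2}, pev P x = 0 → pev P z ≠ 0 → x ≠ z := by
    rintro P x z hx hz rfl
    exact hz hx
  have gy := hGv y (by simp)
  have gi := hGv i (by simp)
  have gj := hGv j (by simp)
  have gk := hGv k (by simp)
  have gl := hGv l (by simp)
  have hyw := ne_of gy hGw
  have hyq := ne_of gy hGq
  obtain ⟨hyi, hyj, hij⟩ := ne_of_cross_ne_zero h
  have hik := (ne_of_cross_ne_zero ck).2.1
  have hjk := (ne_of_cross_ne_zero ck).2.2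
  have hil := (ne_of_cross_ne_zero cl).2.1
  have hjl := (ne_of_cross_ne_zero cl).2.2
  have hyk := (ne_of_cross_ne_zero cik).2.1
  have hyl := (ne_of_cross_ne_zero cil).2.1
  have off : ∀ {z : Cn 2}, cross i j z ≠ 0 → cross y i z ≠ 0 → cross y j z ≠ 0 →
      OffSides y i j z := by
    intro z h1 h2 h3
    exact ⟨h1, by rwa [cross_swap, neg_ne_zero], h2⟩
  have onl : ∀ {m z : Cn 2}, y ≠ z → pev ℓ z = 0 → pev ℓ m ≠ 0 → cross y m z ≠ 0 := by
    intro m z hyz hz hm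
    rw [cross_swap_right, neg_ne_zero]
    exact cross_ne_zero_of_pev hℓ hyz hy hz hm
  have ok := off ck cik cjk
  have ol := off cl cil cjl
  have ow := off cw (onl hyw hw hi) (onl hyw hw hj)
  have oq := off cq (onl hyq hq hi) (onl hyq hq hj)
  have hconic : ∀ {z : Cn 2}, pev G z ≠ 0 → ∀ P : MvPolynomial (Fin 2) ℂ, P.totalDegree ≤ 2 →
      pev P y = 0 → pev P i = 0 → pev P j = 0 → pev P k = 0 → pev P l = 0 → pev P z = 0 →
      P = 0 := by
    intro z hz P hP py pi pj pk pl pz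
    have hcard : ({y, i, j, k, l} : Finset (Cn 2)).card = 5 := by
      simp [*]
    obtain ⟨c, hc⟩ := conic_unique hcard (fun a _ b _ hab => by
        simpa using h4 (lineP a b) (lineP_ne_zero hab) (totalDegree_lineP_le a b)) hP hG hG0
      (by
        intro x hx
        simp only [Finset.mem_insert, Finset.mem_singleton] at hx
        rcases hx with rfl | rfl | rfl | rfl | rfl <;> assumption) hGv
    rw [hc, pev_mul, pev_C] at pz
    rw [hc, (mul_eq_zero.1 pz).resolve_right hz, map_zero, zero_mul]
  -- Three points y, w, q on ℓ force the conic to split; the residual line would contain the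
  -- non-collinear i, j, z.
  have hline : ∀ {z : Cn 2}, pev ℓ z ≠ 0 → cross i j z ≠ 0 → ∀ P : MvPolynomial (Fin 2) ℂ,
      P.totalDegree ≤ 2 → pev P y = 0 → pev P i = 0 → pev P j = 0 → pev P z = 0 → pev P w = 0 →
      pev P q = 0 → P = 0 := by
    intro z hz hijz P hP py pi pj pz pw pq
    obtain ⟨Q, hQ, hQd⟩ := exists_eq_lineP_mul hyw (d := 1) (T := {y, w, q}) hP
      (by rw [Finset.card_eq_three.2 ⟨y, w, q, hyw, hyq, hwq, rfl⟩]; norm_num) (by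
        intro x hx
        simp only [Finset.mem_insert, Finset.mem_singleton] at hx
        rcases hx with rfl | rfl | rfl
        · exact ⟨cross_left _ _, py⟩
        · exact ⟨cross_right _ _, pw⟩
        · exact ⟨cross_eq_zero_of_pev hℓ hℓ0 hy hw hq, pq⟩)
    have hv : ∀ {x : Cn 2}, pev ℓ x ≠ 0 → pev P x = 0 → pev Q x = 0 := by
      intro x hx px
      rw [hQ, pev_mul, pev_lineP] at px
      exact (mul_eq_zero.1 px).resolve_left (cross_ne_zero_of_pev hℓ hyw hy hw hx)
    rw [hQ, eq_zero_of_totalDegree_le_one hijz hQd (hv hi pi) (hv hj pj) (hv hz pz), mul_zero]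
  have hkw := ne_of gk hGw
  have hkq := ne_of gk hGq
  have hlw := ne_of gl hGw
  have hlq := ne_of gl hGq
  have hiw := ne_of gi hGw
  have hiq := ne_of gi hGq
  have hjw := ne_of gj hGw
  have hjq := ne_of gj hGq
  -- Of any three among k, l, w, q, either w and q both occur, and the line argument applies, or k
  -- and l do, and uniqueness of the conic applies.
  obtain ⟨u, hu, hgr, py, pi, pj, pk, pl, pw, pq⟩ := exists_entireGreen_of_general_position h ok ol
    ow oq (conicDet_ne_zero h ol ow hlw (hline hl cl)) (conicDet_ne_zero h ok ow hkw (hline hk ck))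
    (conicDet_ne_zero h ok ol hkl (hconic hGq)) (conicDet_ne_zero h ok ol hkl (hconic hGw))
    (S := {y, i, j, k, l, w, q}) (by simp)
  refine ⟨by simp [*], u, hu, hgr, {y, i, j}, ?_, ?_, ?_, ?_⟩
  · intro z hz
    simp only [Finset.mem_insert, Finset.mem_singleton] at hz ⊢
    tauto
  · exact Finset.card_eq_three.2 ⟨y, i, j, hyi, hyj, hij, rfl⟩
  · intro p hp
    simp only [Finset.mem_insert, Finset.mem_singleton] at hp
    rcases hp with rfl | rfl | rfl <;> assumption
  · intro p hp
    simp only [Finset.mem_sdiff, Finset.mem_insert, Finset.mem_singleton] at hp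
    obtain ⟨rfl | rfl | rfl | rfl | rfl | rfl | rfl, hp⟩ := hp
    · simp at hp
    · simp at hp
    · simp at hp
    all_goals assumption

open scoped Classical in
-- Seven points would mean q and six points of A, at least 6 + 6 - 7 = 5 of them also on G. Then P
-- is proportional to G, which does not vanish at q.
lemma card_filter_conic_le_six {A : Finset (Cn 2)} (hA : A.card = 7)
    (h3 : ∀ P : MvPolynomial (Fin 2) ℂ, P ≠ 0 → P.totalDegree ≤ 1 →
      (A.filter fun z => pev P z = 0).card ≤ 3)
    (h6 : ∀ P : MvPolynomial (Fin 2) ℂ, P ≠ 0 → P.totalDegree ≤ 2 →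
      (A.filter fun z => pev P z = 0).card ≤ 6)
    {G : MvPolynomial (Fin 2) ℂ} (hG : G.totalDegree ≤ 2) (hG0 : G ≠ 0)
    (hG6 : (A.filter fun z => pev G z = 0).card = 6) {q : Cn 2} (hGq : pev G q ≠ 0)
    {P : MvPolynomial (Fin 2) ℂ} (hP0 : P ≠ 0) (hP : P.totalDegree ≤ 2) :
    ((insert q A).filter fun z => pev P z = 0).card ≤ 6 := by
  rw [Finset.filter_insert]
  split_ifs with hPq
  swap
  · exact h6 P hP0 hP
  refine (Finset.card_insert_le _ _).trans ?_
  by_contra! hlt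
  have hle := h6 P hP0 hP
  have hint := Finset.card_union_add_card_inter (A.filter fun z => pev P z = 0)
    (A.filter fun z => pev G z = 0)
  have hun : ((A.filter fun z => pev P z = 0) ∪ (A.filter fun z => pev G z = 0)).card ≤ 7 := by
    rw [← hA]
    exact Finset.card_le_card (Finset.union_subset (Finset.filter_subset _ _)
      (Finset.filter_subset _ _))
  obtain ⟨B, hBsub, hB⟩ := Finset.exists_subset_card_eq (n := 5)
    (s := (A.filter fun z => pev P z = 0) ∩ (A.filter fun z => pev G z = 0)) (by omega)
  have hBm : ∀ z ∈ B, z ∈ A ∧ pev P z = 0 ∧ pev G z = 0 := by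
    intro z hz
    have := hBsub hz
    rw [Finset.mem_inter, Finset.mem_filter, Finset.mem_filter] at this
    exact ⟨this.1.1, this.1.2, this.2.2⟩
  obtain ⟨c, hc⟩ := conic_unique hB (fun a _ b _ hab => by
      have := h3 (lineP a b) (lineP_ne_zero hab) (totalDegree_lineP_le a b)
      simp only [pev_lineP] at this
      exact (Finset.card_le_card (Finset.filter_subset_filter _ fun z hz => (hBm z hz).1)).trans
        this) hP hG hG0 (fun z hz => (hBm z hz).2.1) fun z hz => (hBm z hz).2.2
  rw [hc, pev_mul, pev_C] at hPq
  apply hP0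
  rw [hc, (mul_eq_zero.1 hPq).resolve_right hGq, map_zero, zero_mul]

open scoped Classical in
-- Here E and M are the points of A ∩ Γ on and off ℓ, two and four in number. One point y of E is
-- kept and M is split into {i, j} and {k, l} so that the line ij avoids w and q and no side of the
-- triangle y, i, j meets k or l.
theorem exists_entireGreen_of_four_collinear {A : Finset (Cn 2)} (hA : A.card = 7)
    (h3 : ∀ P : MvPolynomial (Fin 2) ℂ, P ≠ 0 → P.totalDegree ≤ 1 →
      (A.filter fun z => pev P z = 0).card ≤ 3)
    {G : MvPolynomial (Fin 2) ℂ} (hG : G.totalDegree ≤ 2) (hG0 : G ≠ 0)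
    (hG6 : (A.filter fun z => pev G z = 0).card = 6) {q : Cn 2} (hqA : q ∉ A) (hGq : pev G q ≠ 0)
    {ℓ : MvPolynomial (Fin 2) ℂ} (hℓ : ℓ.totalDegree ≤ 1) (hℓ0 : ℓ ≠ 0)
    (hℓ4 : ((insert q A).filter fun z => pev ℓ z = 0).card = 4) :
    ∃ S ⊆ insert q A, S.card = 7 ∧ ∃ u : Cn 2 → EReal, IsEntireGreen S u ∧ growth u = 4 ∧
      ∃ T ⊆ S, T.card = 3 ∧ (∀ p ∈ T, HasLogPole u 2 p) ∧ ∀ p ∈ S \ T, HasLogPole u 1 p := by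
  have hℓ3 := h3 ℓ hℓ0 hℓ
  have hq : pev ℓ q = 0 := by
    by_contra hq
    rw [Finset.filter_insert, if_neg hq] at hℓ4
    omega
  rw [Finset.filter_insert, if_pos hq,
    Finset.card_insert_of_notMem fun h => hqA (Finset.mem_filter.1 h).1] at hℓ4
  obtain ⟨w, hw⟩ := Finset.card_eq_one.1 (show (A.filter fun z => ¬ pev G z = 0).card = 1 by
    have := Finset.card_filter_add_card_filter_not (s := A) (fun z => pev G z = 0)
    omega)
  have hwm : w ∈ A ∧ ¬ pev G w = 0 := by
    have : w ∈ A.filter fun z => ¬ pev G z = 0 := by rw [hw]; exact Finset.mem_singleton_self w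
    exact Finset.mem_filter.1 this
  set Γ := A.filter fun z => pev G z = 0 with hΓ
  have hΓm : ∀ {z}, z ∈ Γ ↔ z ∈ A ∧ pev G z = 0 := Finset.mem_filter
  set E := Γ.filter fun z => pev ℓ z = 0 with hE
  set M := Γ.filter fun z => ¬ pev ℓ z = 0 with hM
  have hEm : ∀ {z}, z ∈ E ↔ z ∈ Γ ∧ pev ℓ z = 0 := Finset.mem_filter
  have hMm : ∀ {z}, z ∈ M ↔ z ∈ Γ ∧ ¬ pev ℓ z = 0 := Finset.mem_filter
  have hEM : E.card + M.card = 6 := by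
    rw [← hG6]; exact Finset.card_filter_add_card_filter_not (fun z => pev ℓ z = 0)
  -- Three points of the conic on ℓ would make ℓ a component, putting q on it.
  have hE2 : E.card ≤ 2 := by
    by_contra! hlt
    obtain ⟨x, hx, y, hy, hxy⟩ := Finset.one_lt_card.1 (show 1 < E.card by omega)
    have hx' := (hEm.1 hx).2
    have hy' := (hEm.1 hy).2
    obtain ⟨Q, hQ, -⟩ := exists_eq_lineP_mul hxy (d := 1) hG hlt fun z hz =>
      ⟨cross_eq_zero_of_pev hℓ hℓ0 hx' hy' (hEm.1 hz).2, (hΓm.1 (hEm.1 hz).1).2⟩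
    apply hGq
    rw [hQ, pev_mul, pev_lineP, cross_eq_zero_of_pev hℓ hℓ0 hx' hy' hq, zero_mul]
  have hsplit : (A.filter fun z => pev ℓ z = 0) ⊆ E ∪ ({w} : Finset (Cn 2)) := by
    intro z hz
    rw [Finset.mem_filter] at hz
    by_cases hGz : pev G z = 0
    · exact Finset.mem_union_left _ (hEm.2 ⟨hΓm.2 ⟨hz.1, hGz⟩, hz.2⟩)
    · refine Finset.mem_union_right _ ?_
      rw [← hw]
      exact Finset.mem_filter.2 ⟨hz.1, hGz⟩
  have hwℓ : pev ℓ w = 0 := by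
    by_contra hwℓ
    have : (A.filter fun z => pev ℓ z = 0) ⊆ E := by
      intro z hz
      rcases Finset.mem_union.1 (hsplit hz) with h | h
      · exact h
      · rw [Finset.mem_singleton.1 h] at hz
        exact absurd (Finset.mem_filter.1 hz).2 hwℓ
    have := Finset.card_le_card this
    omega
  have hEcard : E.card = 2 := by
    have h1 := (Finset.card_le_card hsplit).trans (Finset.card_union_le _ _)
    rw [Finset.card_singleton] at h1
    omega
  have hwq : w ≠ q := by rintro rfl; exact hqA hwm.1
  -- the configuration suffices
  have finish : ∀ {y i j k l : Cn 2}, y ∈ E → i ∈ M → j ∈ M → k ∈ M → l ∈ M → k ≠ l →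
      cross i j y ≠ 0 → cross i j k ≠ 0 → cross i j l ≠ 0 → cross i j w ≠ 0 → cross i j q ≠ 0 →
      cross y i k ≠ 0 → cross y i l ≠ 0 → cross y j k ≠ 0 → cross y j l ≠ 0 →
      ∃ S ⊆ insert q A, S.card = 7 ∧ ∃ u : Cn 2 → EReal, IsEntireGreen S u ∧ growth u = 4 ∧
      ∃ T ⊆ S, T.card = 3 ∧ (∀ p ∈ T, HasLogPole u 2 p) ∧ ∀ p ∈ S \ T, HasLogPole u 1 p := by
    intro y i j k l hy hi hj hk hl hkl cy ck cl cw cq cik cil cjk cjl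
    have hsub : ∀ z ∈ ({y, i, j, k, l} : Finset (Cn 2)), z ∈ Γ := by
      intro z hz
      simp only [Finset.mem_insert, Finset.mem_singleton] at hz
      rcases hz with rfl | rfl | rfl | rfl | rfl
      · exact (hEm.1 hy).1
      · exact (hMm.1 hi).1
      · exact (hMm.1 hj).1
      · exact (hMm.1 hk).1
      · exact (hMm.1 hl).1
    refine ⟨{y, i, j, k, l, w, q}, ?_, exists_entireGreen_of_conic_of_line hG hG0
      (fun z hz => (hΓm.1 (hsub z hz)).2) hwm.2 hGq (fun P hP0 hP =>
        (Finset.card_le_card (Finset.filter_subset_filter _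
          fun z hz => (hΓm.1 (hsub z hz)).1)).trans (h3 P hP0 hP)) hℓ hℓ0 (hEm.1 hy).2 hwℓ hq
      (hMm.1 hi).2 (hMm.1 hj).2 (hMm.1 hk).2 (hMm.1 hl).2 hwq hkl cy ck cl cw cq cik cil cjk cjl⟩
    have hsub' : ∀ z ∈ ({y, i, j, k, l} : Finset (Cn 2)), z ∈ A := fun z hz => (hΓm.1 (hsub z hz)).1
    intro z hz
    simp only [Finset.mem_insert, Finset.mem_singleton] at hz hsub' ⊢
    rcases hz with h | h | h | h | h | h | h
    iterate 5 exact Or.inr (hsub' z (by tauto))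
    · exact Or.inr (h ▸ hwm.1)
    · exact Or.inl h
  by_cases hcol : ∃ x ∈ Γ, ∃ y ∈ Γ, ∃ z ∈ Γ, x ≠ y ∧ x ≠ z ∧ y ≠ z ∧ cross x y z = 0
  · obtain ⟨p₁, hp₁, p₂, hp₂, p₃, hp₃, h₁₂, h₁₃, h₂₃, hp⟩ := hcol
    obtain ⟨N₂, hN, hN₂⟩ := exists_eq_lineP_mul h₁₂ (d := 1) (T := {p₁, p₂, p₃}) hG
      (by rw [Finset.card_eq_three.2 ⟨p₁, p₂, p₃, h₁₂, h₁₃, h₂₃, rfl⟩]; norm_num) (by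
        intro z hz
        simp only [Finset.mem_insert, Finset.mem_singleton] at hz
        rcases hz with rfl | rfl | rfl
        · exact ⟨cross_left _ _, (hΓm.1 hp₁).2⟩
        · exact ⟨cross_right _ _, (hΓm.1 hp₂).2⟩
        · exact ⟨hp, (hΓm.1 hp₃).2⟩)
    set N₁ := lineP p₁ p₂ with hN₁def
    have hN₁ : N₁.totalDegree ≤ 1 := totalDegree_lineP_le _ _
    have hN₁0 : N₁ ≠ 0 := lineP_ne_zero h₁₂
    have hN₂0 : N₂ ≠ 0 := by rintro rfl; exact hG0 (by rw [hN, mul_zero])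
    have hΓA : Γ ⊆ A := Finset.filter_subset _ _
    have c₁ := (Finset.card_le_card (Finset.filter_subset_filter (fun z => pev N₁ z = 0)
      hΓA)).trans (h3 N₁ hN₁0 hN₁)
    have c₂ := (Finset.card_le_card (Finset.filter_subset_filter (fun z => pev N₂ z = 0)
      hΓA)).trans (h3 N₂ hN₂0 hN₂)
    have hor : ∀ z ∈ Γ, pev N₁ z = 0 ∨ pev N₂ z = 0 := by
      intro z hz
      have := (hΓm.1 hz).2
      rwa [hN, pev_mul, mul_eq_zero] at this
    have hunion : (Γ.filter fun z => pev N₁ z = 0) ∪ (Γ.filter fun z => pev N₂ z = 0) = Γ := by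
      rw [← Finset.filter_or]
      exact Finset.filter_true_of_mem hor
    -- Γ splits into two lines with at most three points of A each; six points force exactly three
    -- on each and none on both.
    have hcard := Finset.card_union_add_card_inter (Γ.filter fun z => pev N₁ z = 0)
      (Γ.filter fun z => pev N₂ z = 0)
    rw [hunion] at hcard
    have hdisj : ∀ z ∈ Γ, pev N₁ z = 0 → pev N₂ z = 0 → False := by
      intro z hz z₁ z₂
      have : ((Γ.filter fun z => pev N₁ z = 0) ∩ (Γ.filter fun z => pev N₂ z = 0)).card = 0 := by
        omega
      rw [Finset.card_eq_zero, Finset.eq_empty_iff_forall_notMem] at this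
      exact this z (Finset.mem_inter.2 ⟨Finset.mem_filter.2 ⟨hz, z₁⟩, Finset.mem_filter.2 ⟨hz, z₂⟩⟩)
    -- One point of E lies on each line. Take i, j as the other two points of N, and y, k, l as the
    -- three points of N'. The collinearity of y, k, l is harmless, since N' is not a side of the
    -- triangle y, i, j.
    have main : ∀ {N N' : MvPolynomial (Fin 2) ℂ} {x y : Cn 2}, N.totalDegree ≤ 1 →
        N'.totalDegree ≤ 1 → G = N * N' → (∀ z, z ∈ E ↔ z = x ∨ z = y) →
        pev N x = 0 → pev N' y = 0 → (Γ.filter fun z => pev N z = 0).card = 3 →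
        (Γ.filter fun z => pev N' z = 0).card = 3 →
        (∀ z ∈ Γ, pev N z = 0 → pev N' z = 0 → False) →
        ∃ S ⊆ insert q A, S.card = 7 ∧ ∃ u : Cn 2 → EReal, IsEntireGreen S u ∧ growth u = 4 ∧
        ∃ T ⊆ S, T.card = 3 ∧ (∀ p ∈ T, HasLogPole u 2 p) ∧
          ∀ p ∈ S \ T, HasLogPole u 1 p := by
      intro N N' x y hNd hN'd hNN hExy hx hy hc hc' hdis
      have hxE : x ∈ E := (hExy x).2 (Or.inl rfl)
      have hyE : y ∈ E := (hExy y).2 (Or.inr rfl)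
      have hxΓ := (hEm.1 hxE).1
      have hyΓ := (hEm.1 hyE).1
      obtain ⟨i, j, hij, hijE⟩ := Finset.card_eq_two.1
        (show ((Γ.filter fun z => pev N z = 0).erase x).card = 2 by
          rw [Finset.card_erase_of_mem (Finset.mem_filter.2 ⟨hxΓ, hx⟩), hc])
      obtain ⟨k, l, hkl, hklE⟩ := Finset.card_eq_two.1
        (show ((Γ.filter fun z => pev N' z = 0).erase y).card = 2 by
          rw [Finset.card_erase_of_mem (Finset.mem_filter.2 ⟨hyΓ, hy⟩), hc'])
      have hmem : ∀ z, z = i ∨ z = j → z ∈ Γ ∧ pev N z = 0 ∧ z ∈ M := by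
        intro z hz
        have hz' : z ∈ (Γ.filter fun z => pev N z = 0).erase x := by
          rw [hijE]; simpa using hz
        rw [Finset.mem_erase, Finset.mem_filter] at hz'
        refine ⟨hz'.2.1, hz'.2.2, hMm.2 ⟨hz'.2.1, fun h => ?_⟩⟩
        rcases (hExy z).1 (hEm.2 ⟨hz'.2.1, h⟩) with h | h
        · exact hz'.1 h
        · subst h; exact hdis z hyΓ hz'.2.2 hy
      have hmem' : ∀ z, z = k ∨ z = l → y ≠ z ∧ z ∈ Γ ∧ pev N' z = 0 ∧ z ∈ M := by
        intro z hz
        have hz' : z ∈ (Γ.filter fun z => pev N' z = 0).erase y := by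
          rw [hklE]; simpa using hz
        rw [Finset.mem_erase, Finset.mem_filter] at hz'
        refine ⟨hz'.1.symm, hz'.2.1, hz'.2.2, hMm.2 ⟨hz'.2.1, fun h => ?_⟩⟩
        rcases (hExy z).1 (hEm.2 ⟨hz'.2.1, h⟩) with h | h
        · subst h; exact hdis z hxΓ hx hz'.2.2
        · exact hz'.1 h
      obtain ⟨iΓ, iN, iM⟩ := hmem i (Or.inl rfl)
      obtain ⟨jΓ, jN, jM⟩ := hmem j (Or.inr rfl)
      obtain ⟨yk, kΓ, kN, kM⟩ := hmem' k (Or.inl rfl)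
      obtain ⟨yl, lΓ, lN, lM⟩ := hmem' l (Or.inr rfl)
      have off : ∀ {z}, pev G z ≠ 0 → pev N z ≠ 0 := fun hz h => hz (by
        rw [hNN, pev_mul, h, zero_mul])
      have cN : ∀ {z}, pev N z ≠ 0 → cross i j z ≠ 0 := cross_ne_zero_of_pev hNd hij iN jN
      have cN' : ∀ {m z}, y ≠ z → pev N' z = 0 → pev N' m ≠ 0 → cross y m z ≠ 0 := by
        intro m z hyz hz hm
        rw [cross_swap_right, neg_ne_zero]
        exact cross_ne_zero_of_pev hN'd hyz hy hz hm
      exact finish hyE iM jM kM lM hkl (cN fun h => hdis y hyΓ h hy)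
        (cN fun h => hdis k kΓ h kN) (cN fun h => hdis l lΓ h lN) (cN (off hwm.2)) (cN (off hGq))
        (cN' yk kN (hdis i iΓ iN)) (cN' yl lN (hdis i iΓ iN)) (cN' yk kN (hdis j jΓ jN))
        (cN' yl lN (hdis j jΓ jN))
    obtain ⟨x, y, hxy, hExy⟩ := Finset.card_eq_two.1 hEcard
    have hE' : ∀ z, z ∈ E ↔ z = x ∨ z = y := fun z => by rw [hExy]; simp
    have hE'' : ∀ z, z ∈ E ↔ z = y ∨ z = x := fun z => by rw [hE', or_comm]
    have hx := hEm.1 ((hE' x).2 (Or.inl rfl))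
    have hy := hEm.1 ((hE' y).2 (Or.inr rfl))
    have hline := cross_eq_zero_of_pev hℓ hℓ0 hx.2 hy.2 hq
    -- If both points of E were on the same component, that component would be ℓ and contain q.
    rcases hor x hx.1 with hx' | hx' <;> rcases hor y hy.1 with hy' | hy'
    · refine absurd ?_ hGq
      rw [hN, pev_mul, pev_eq_zero_of_cross hN₁ hxy hx' hy' hline, zero_mul]
    · exact main hN₁ hN₂ hN hE' hx' hy' (by omega) (by omega) hdisj
    · exact main hN₁ hN₂ hN hE'' hy' hx' (by omega) (by omega) hdisj
    · refine absurd ?_ hGq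
      rw [hN, pev_mul, pev_eq_zero_of_cross hN₂ hxy hx' hy' hline, mul_zero]
  · push Not at hcol
    obtain ⟨y, hy⟩ := Finset.card_pos.1 (show 0 < E.card by omega)
    obtain ⟨i, hi⟩ := Finset.card_pos.1 (show 0 < M.card by omega)
    have hiΓ := (hMm.1 hi).1
    have hcard : (M.erase i).card = 3 := by rw [Finset.card_erase_of_mem hi]; omega
    -- Without collinear triples, i is joined through v to at most one other point. Applied to w and
    -- q, this excludes at most two of the three candidates for j.
    have hbad : ∀ {v : Cn 2}, pev G v ≠ 0 →
        ((M.erase i).filter fun j => cross i j v = 0).card ≤ 1 := by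
      intro v hv
      refine Finset.card_le_one.2 fun j hj j' hj' => ?_
      rw [Finset.mem_filter, Finset.mem_erase] at hj hj'
      by_contra hne
      refine hcol i hiΓ j (hMm.1 hj.1.2).1 j' (hMm.1 hj'.1.2).1 hj.1.1.symm hj'.1.1.symm hne
        (cross_eq_zero_trans ?_ hj.2 hj'.2)
      rintro rfl
      exact hv (hΓm.1 hiΓ).2
    obtain ⟨j, hj, hjbad⟩ := Finset.exists_mem_notMem_of_card_lt_card
      (s := ((M.erase i).filter fun j => cross i j w = 0) ∪
        ((M.erase i).filter fun j => cross i j q = 0)) (t := M.erase i) (by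
      have := Finset.card_union_le ((M.erase i).filter fun j => cross i j w = 0)
        ((M.erase i).filter fun j => cross i j q = 0)
      have := hbad hwm.2
      have := hbad hGq
      omega)
    simp only [Finset.mem_union, Finset.mem_filter, not_or, not_and] at hjbad
    obtain ⟨k, l, hkl, hklE⟩ := Finset.card_eq_two.1
      (show ((M.erase i).erase j).card = 2 by rw [Finset.card_erase_of_mem hj, hcard])
    have hmem : ∀ z, z = k ∨ z = l → z ≠ j ∧ z ≠ i ∧ z ∈ M := by
      intro z hz
      have hz' : z ∈ (M.erase i).erase j := by rw [hklE]; simpa using hz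
      rwa [Finset.mem_erase, Finset.mem_erase] at hz'
    obtain ⟨kj, ki, kM⟩ := hmem k (Or.inl rfl)
    obtain ⟨lj, li, lM⟩ := hmem l (Or.inr rfl)
    obtain ⟨ji, jM⟩ := Finset.mem_erase.1 hj
    have yne : ∀ {z}, z ∈ M → y ≠ z := by
      rintro z hz rfl
      exact (hMm.1 hz).2 (hEm.1 hy).2
    have hyΓ := (hEm.1 hy).1
    have mΓ : ∀ {z}, z ∈ M → z ∈ Γ := fun hz => (hMm.1 hz).1
    exact finish hy hi jM kM lM hkl
      (hcol i hiΓ j (mΓ jM) y hyΓ ji.symm (yne hi).symm (yne jM).symm)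
      (hcol i hiΓ j (mΓ jM) k (mΓ kM) ji.symm ki.symm kj.symm)
      (hcol i hiΓ j (mΓ jM) l (mΓ lM) ji.symm li.symm lj.symm) (hjbad.1 hj) (hjbad.2 hj)
      (hcol y hyΓ i hiΓ k (mΓ kM) (yne hi) (yne kM) ki.symm)
      (hcol y hyΓ i hiΓ l (mΓ lM) (yne hi) (yne lM) li.symm)
      (hcol y hyΓ j (mΓ jM) k (mΓ kM) (yne jM) (yne kM) kj.symm)
      (hcol y hyΓ j (mΓ jM) l (mΓ lM) (yne jM) (yne lM) lj.symm)

end PluriGreen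

/-! ### The main theorem. -/

open PluriGreen in
open scoped Classical in
theorem proposition2p4 (A : Finset (Cn 2)) (hA : A.card = 7)
    (h1 : maxOnCurve 1 A ≤ 3) (h2 : maxOnCurve 2 A = 6)
    (Γ : Set (Cn 2)) (hΓ : IsAlgCurve 2 Γ) (hAΓ : ((A : Set (Cn 2)) ∩ Γ).ncard = 6)
    (q : Cn 2) (hqA : q ∉ A) (hqΓ : q ∉ Γ) :
    maxOnCurve 1 (insert q A) ≤ 4 ∧
    (maxOnCurve 1 (insert q A) ≤ 3 →
      ∃ u : Cn 2 → EReal, IsPSH u Set.univ ∧ growth u = 3 ∧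
        (∃ F : Set (Cn 2), F.Finite ∧ LocallyBddOn u Fᶜ) ∧
        ∀ p ∈ insert q A, LogUpperBoundAt u 1 p) ∧
    (maxOnCurve 1 (insert q A) = 4 →
      ∃ S ⊆ insert q A, S.card = 7 ∧
        ∃ u : Cn 2 → EReal, IsEntireGreen S u ∧ growth u = 4 ∧
          ∃ T ⊆ S, T.card = 3 ∧ (∀ p ∈ T, HasLogPole u 2 p) ∧
            ∀ p ∈ S \ T, HasLogPole u 1 p) := by
  obtain ⟨G, hGd, rfl⟩ := hΓ
  rw [ncard_inter_curve] at hAΓ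
  have hGq : pev G q ≠ 0 := hqΓ
  have hG0 : G ≠ 0 := by rintro rfl; simp at hGd
  have h3 : ∀ P : MvPolynomial (Fin 2) ℂ, P ≠ 0 → P.totalDegree ≤ 1 →
      (A.filter fun z => pev P z = 0).card ≤ 3 := fun P hP0 hP =>
    (card_filter_le_maxOnCurve hP0 hP).trans h1
  have h6 : ∀ P : MvPolynomial (Fin 2) ℂ, P ≠ 0 → P.totalDegree ≤ 2 →
      (A.filter fun z => pev P z = 0).card ≤ 6 := fun P hP0 hP =>
    (card_filter_le_maxOnCurve hP0 hP).trans h2.le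
  refine ⟨?_, fun h => ?_, fun h => ?_⟩
  · refine csSup_le' ?_
    rintro _ ⟨Z, ⟨P, hP, rfl⟩, rfl⟩
    have hP0 : P ≠ 0 := by rintro rfl; simp at hP
    rw [ncard_inter_curve, Finset.filter_insert]
    have := h3 P hP0 hP.le
    split_ifs
    · exact (Finset.card_insert_le _ _).trans (by omega)
    · omega
  · exact exists_psh_of_eight_points (by rw [Finset.card_insert_of_notMem hqA, hA])
      (fun P hP0 hP => (card_filter_le_maxOnCurve hP0 hP).trans h)
      fun P hP0 hP => card_filter_conic_le_six hA h3 h6 hGd.le hG0 hAΓ hGq hP0 hP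
  · obtain ⟨Z, ⟨ℓ, hℓ, rfl⟩, hcard⟩ := exists_ncard_eq_maxOnCurve (j := 1) (S := insert q A)
      (by rw [h]; norm_num)
    rw [h, ncard_inter_curve] at hcard
    exact exists_entireGreen_of_four_collinear hA h3 hGd.le hG0 hAΓ hqA hGq hℓ.le
      (by rintro rfl; simp at hℓ) hcard
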